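/- Let $K$ be an infinite field, $n\ge 0$, $R=K[x_1,\dots,x_n]$ with the standard grading, $\mathfrak m=(x_1,\dots,x_n)$, and let $I$ be a graded ideal of $R$. "A general linear form" (or "$n$ general linear forms") has a property if the property holds for all coefficient vectors in a nonempty Zariski open subset; $l$ denotes length and $\mu(I)$ the minimal number of generators of $I$. *Completely $\mathfrak m$-full ideals* are defined by recursion on $n$: for $n=0$ only the zero ideal of $K$ is completely $\mathfrak m$-full; for $n>0$, $I$ is completely $\mathfrak m$-full if for a general linear form $z$ one has $\mathfrak mI:z=I$ and $(I+zR)/zR$ is completely $\mathfrak m$-full in the polynomial ring $R/zR$. The *$t$-value* of $I$ is $t(I)=l\big((IR':_{R'}Y)/IR'\big)$, where $R'$ is the localization of $R[X_1,\dots,X_n]$ at the prime ideal $\mathfrak mR[X_1,\dots,X_n]$ and $Y=X_1x_1+\cdots+X_nx_n$. For general linear forms $z_1,\dots,z_n$ (which generate $\mathfrak m$), let $R^{(n)}=R$ and $R^{(i)}=R/(z_{i+1},\dots,z_n)R$ for $0\le i<n$, a polynomial ring in the images of $z_1,\dots,z_i$, and let $t_i$ be the $t$-value of $IR^{(i+1)}$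 for $0\le i\le n-1$. **Theorem.** For general $z_1,\dots,z_n$ the values $t_0,\dots,t_{n-1}$ are finite and do not depend on the choice of $z_1,\dots,z_n$, so that the *$t$-sequence* $t_0,\dots,t_{n-1}$ of $I$ is well defined. Put $B(I)=t_0+\cdots+t_{n-1}$. Then $I$ is completely $\mathfrak m$-full if and only if $\mu(I)=B(I)$. Moreover, if $I\ne R$, then $\mu(I)\le B(I)$. -/

import Mathlib

open MvPolynomial

attribute [local instance] MvPolynomial.gradedAlgebra

/-- A property of points of the affine space `K^σ` holds for a general point if it holds on a
nonempty Zariski open subset; over an infinite field `K` such a subset contains a nonempty basic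
open set `{a | F a ≠ 0}` with `F` a nonzero polynomial, and conversely. -/
def HoldsGenerally {K σ : Type*} [Field K] (P : (σ → K) → Prop) : Prop :=
  ∃ F : MvPolynomial σ K, F ≠ 0 ∧ ∀ a : σ → K, eval a F ≠ 0 → P a

/-- The length of `(J : z) / J`. -/
noncomputable def colonLength {A : Type*} [CommRing A] (J : Ideal A) (z : A) : ℕ∞ :=
  Module.length A (↥(J.colon {z}) ⧸ J.submoduleOf (J.colon {z}))

/-- The recursive definition of completely `𝔪`-full ideals, for a polynomial ring `A` in `d`
variables over `K` whose space of linear forms is spanned by the finite family `x` (the family may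
have more than `d` members, so that it can be pushed forward to `A ⧸ (z)`). Here `𝔪` is the ideal
generated by `x`, and a general linear form is `∑ i, a i • x i` for general `a`. -/
def IsCompletelyMFullAux (K : Type*) [Field K] {σ : Type*} [Fintype σ] :
    (d : ℕ) → (A : Type*) → [CommRing A] → [Algebra K A] → (x : σ → A) → (I : Ideal A) → Prop
  | 0, _, _, _, _, I => I = ⊥
  | d + 1, A, _, _, x, I =>
      HoldsGenerally fun a : σ → K =>
        (Ideal.span (Set.range x) * I).colon {∑ i, a i • x i} = I ∧
          IsCompletelyMFullAux K d (A ⧸ Ideal.span {∑ i, a i • x i})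
            (fun i => Ideal.Quotient.mk (Ideal.span {∑ i, a i • x i}) (x i))
            (I.map (Ideal.Quotient.mk (Ideal.span {∑ i, a i • x i})))

/-- Completely `𝔪`-full ideals of `K[x_1, …, x_n]`. -/
def IsCompletelyMFull {K : Type*} [Field K] {n : ℕ} (I : Ideal (MvPolynomial (Fin n) K)) : Prop :=
  IsCompletelyMFullAux K n (MvPolynomial (Fin n) K) X I

instance isPrime_map_mvPolynomial_C {A τ : Type*} [CommRing A] (m : Ideal A) [m.IsPrime] :
    (m.map (C : A →+* MvPolynomial τ A)).IsPrime := by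
  rw [← Ideal.mk_ker (I := m), ← ker_map]
  exact RingHom.ker_isPrime _

/-- The `t`-value of an ideal `I` of a polynomial ring `A` with variables `x` and graded maximal
ideal `m`: the length of `(I R' : Y) / I R'`, where `R'` is `A[X_j]` localized at the prime ideal
`m A[X_j]`, with one new indeterminate `X_j` for every variable `x_j`, and `Y = ∑ j, X_j x_j`. -/
noncomputable def tValue {A τ : Type*} [CommRing A] [Fintype τ] (x : τ → A) (m : Ideal A)
    [m.IsPrime] (I : Ideal A) : ℕ∞ :=
  colonLength
    ((I.map (C : A →+* MvPolynomial τ A)).map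
      (algebraMap (MvPolynomial τ A)
        (Localization.AtPrime (m.map (C : A →+* MvPolynomial τ A)))))
    (algebraMap (MvPolynomial τ A)
      (Localization.AtPrime (m.map (C : A →+* MvPolynomial τ A)))
      (∑ j, X j * C (x j)))

/-- The graded maximal ideal `𝔪 = (x_1, …, x_n)` is prime. -/
instance isPrime_idealOfVars (K : Type*) [Field K] (n : ℕ) : (idealOfVars (Fin n) K).IsPrime := by
  have h : idealOfVars (Fin n) K = RingHom.ker (constantCoeff : MvPolynomial (Fin n) K →+* K) := by
    ext f
    have h1 := mem_pow_idealOfVars_iff' (σ := Fin n) (R := K) 1 f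
    rw [pow_one] at h1
    rw [h1, RingHom.mem_ker, constantCoeff_eq]
    constructor
    · intro hf
      exact hf 0 (by simp)
    · intro hf x hx
      rwa [(Finsupp.degree_eq_zero_iff x).mp (Nat.lt_one_iff.mp hx)]
  rw [h]
  exact RingHom.ker_isPrime _

/-- The `n` linear forms whose coefficients are the rows of `a`. -/
noncomputable def linForm {K : Type*} [Field K] {n : ℕ} (a : Fin n × Fin n → K) (j : Fin n) :
    MvPolynomial (Fin n) K :=
  ∑ k, a (j, k) • X k

/-- The ideal `(z_j : j > i)` generated by the linear forms after the `i`-th one. -/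
noncomputable def tailIdeal {K : Type*} [Field K] {n : ℕ} (a : Fin n × Fin n → K) (i : Fin n) :
    Ideal (MvPolynomial (Fin n) K) :=
  Ideal.span (linForm a '' Set.Ioi i)

instance isPrime_map_tailIdeal {K : Type*} [Field K] {n : ℕ} (a : Fin n × Fin n → K)
    (i : Fin n) : ((idealOfVars (Fin n) K).map (Ideal.Quotient.mk (tailIdeal a i))).IsPrime := by
  refine Ideal.map_isPrime_of_surjective Ideal.Quotient.mk_surjective ?_
  rw [Ideal.mk_ker, tailIdeal, Ideal.span_le]
  rintro _ ⟨j, -, rfl⟩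
  exact Submodule.sum_mem _ fun k _ =>
    Submodule.smul_of_tower_mem _ _ (Ideal.subset_span ⟨k, rfl⟩)

/-- The `t`-value of the image of `I` in the section `K[x_1, …, x_n] / (z_j : j > i)`, which is a
polynomial ring in the images of the `z_j`, `j ≤ i`, if the `z_j` generate `𝔪`. -/
noncomputable def tValueSection {K : Type*} [Field K] {n : ℕ} (I : Ideal (MvPolynomial (Fin n) K))
    (a : Fin n × Fin n → K) (i : Fin n) : ℕ∞ :=
  tValue (fun j : Set.Iic i => Ideal.Quotient.mk (tailIdeal a i) (linForm a j))
    ((idealOfVars (Fin n) K).map (Ideal.Quotient.mk (tailIdeal a i)))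
    (I.map (Ideal.Quotient.mk (tailIdeal a i)))

/-- `t` is the `t`-sequence of `I`: `n` general linear forms generate `𝔪`, and the `t`-values of
the images of `I` in the successive sections that they define are the members of `t`. -/
def IsTSequence {K : Type*} [Field K] {n : ℕ} (I : Ideal (MvPolynomial (Fin n) K))
    (t : Fin n → ℕ) : Prop :=
  HoldsGenerally fun a : Fin n × Fin n → K =>
    Ideal.span (Set.range (linForm a)) = idealOfVars (Fin n) K ∧ ∀ i, tValueSection I a i = t i

/-! Let `z_i` be the linear forms and `T_d` the ideal generated by the `z_j` with `j ≥ d`. For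
ideals `U ⊆ V ⊆ U : z` the isomorphism theorems give `l(V/U) + l((U:z)/V) = l((V+(z))/(U+(z))) +
l((V:z)/V)`. Apply this to `V = I + T_{i+1}`, `U = 𝔪I + T_{i+1}`, `z = z_i` and add over `i`. The
terms `l(V/U)` telescope: for `T_n = 0` the value is `l(I/𝔪I) = μ(I)`, and for `T_0 = 𝔪` it is `0`
if `I ⊆ 𝔪`. So `μ(I)` plus the sum of the defects `l((𝔪I : z_i)/I)`, taken in the sections, is the
sum of the `l((I : z_i)/I)` (`spanFinrank_add_sum_idealLength`). Once the latter are known to be the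
finite numbers `t_i`, it follows that `μ(I) ≤ B(I)`, with equality exactly when `𝔪I : z_i = I` in
every section. For proper `I` this is complete `𝔪`-fullness, because choosing general forms one
after the other amounts to choosing them jointly (`sectionMFull_of_forall_colonCondition`,
`exists_colonCondition_of_sectionMFull`).

It remains to see that `l((I : z_i)/I)` is finite, constant and equal to the `t`-value. An element
outside `𝔪R[X]` is a nonzero element of `K[X]` plus one that acts nilpotently on the kernel of `Y`;
hence localizing does no more than extend the coefficients to `K(X)`, and the `t`-value is a
dimension over `K(X)` (`tValue_quotient_eq_finrank`). That kernel and the kernels at rational points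
are specializations of a single family over the ring of polynomials in the matrix entries. A Gröbner
basis over a domain for a degree order survives every specialization that keeps its leading
coefficients nonzero, so all these kernels have the same Hilbert function
(`exists_generic_finrank_mulKer`). Avoidance of associated primes yields one rational point with
finite-dimensional kernel, and constancy carries its dimension to all the others
(`exists_generic_tValueSection`). -/

/-! ### Gröbner bases over a domain and generic freeness. -/

open scoped MonomialOrder in
/-- Pseudo-division: modulo `J`, every polynomial has a multiple by an element of `M` that is
congruent to a polynomial without exponents in the ideal generated by the leading exponents
of `G`. -/
theorem exists_pseudo_normalForm {S σ : Type*} [CommRing S] (m : MonomialOrder σ)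
    (J : Ideal (MvPolynomial σ S)) (G : Set (MvPolynomial σ S)) (hG : G ⊆ J)
    (M : Submonoid S) (hM : ∀ g ∈ G, m.leadingCoeff g ∈ M) (a : m.syn) :
    ∀ f : MvPolynomial σ S, (∀ c ∈ f.support, m.toSyn c ≤ a) →
      ∃ s ∈ M, ∃ r : MvPolynomial σ S, (∀ c ∈ r.support, ∀ g ∈ G, ¬ m.degree g ≤ c) ∧
        (∀ c ∈ r.support, m.toSyn c ≤ a) ∧ s • f - r ∈ J := by
  classical
  induction a using WellFoundedLT.induction with
  | ind a ih =>
  -- If all exponents are strictly below `a`, the leading exponent of `f` is a smaller bound to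
  -- which induction applies.
  have lower : ∀ f : MvPolynomial σ S, (∀ c ∈ f.support, m.toSyn c < a) →
      ∃ s ∈ M, ∃ r : MvPolynomial σ S, (∀ c ∈ r.support, ∀ g ∈ G, ¬ m.degree g ≤ c) ∧
        (∀ c ∈ r.support, m.toSyn c ≤ a) ∧ s • f - r ∈ J := by
    intro f hf
    by_cases h0 : f = 0
    · exact ⟨1, M.one_mem, 0, by simp, by simp, by simp [h0]⟩
    · have hlt := hf _ (m.degree_mem_support h0)
      obtain ⟨s, hs, r, h1, h2, h3⟩ := ih _ hlt f (fun c hc => m.le_degree hc)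
      exact ⟨s, hs, r, h1, fun c hc => (h2 c hc).trans hlt.le, h3⟩
  intro f hf
  set α := m.toSyn.symm a with hα
  have ha : m.toSyn α = a := by simp [hα]
  by_cases hstd : ∃ g ∈ G, m.degree g ≤ α
  · obtain ⟨g, hg, hle⟩ := hstd
    obtain ⟨β, hβ⟩ := exists_add_of_le hle
    -- The leading coefficient of `g` need not be invertible, so `f` is scaled by it before the term
    -- at `α` is cancelled.
    obtain ⟨s, hs, r, h1, h2, h3⟩ := lower
      (m.leadingCoeff g • f - monomial β (coeff α f) * g) (by
        intro c hc
        have hle : m.toSyn c ≤ a := by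
          rw [mem_support_iff] at hc
          by_contra hlt
          rw [not_le] at hlt
          apply hc
          rw [coeff_sub, coeff_smul, notMem_support_iff.mp (fun h => (hf c h).not_gt hlt),
            notMem_support_iff (p := monomial β (coeff α f) * g) |>.mp]
          · simp
          · intro h
            have h4 := m.le_degree h
            have h5 := h4.trans (m.degree_mul_le (f := monomial β (coeff α f)) (g := g))
            rw [map_add] at h5
            have h6 := m.degree_monomial_le (d := β) (coeff α f)
            have h7 : m.toSyn c ≤ a := by
              rw [← ha, hβ, map_add, add_comm]
              exact h5.trans (by gcongr)
            exact h7.not_gt hlt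
        refine lt_of_le_of_ne hle ?_
        intro hca
        rw [← ha, m.toSyn.injective.eq_iff] at hca
        subst hca
        rw [mem_support_iff] at hc
        apply hc
        have : coeff α (monomial β (coeff α f) * g) = coeff α f * m.leadingCoeff g := by
          have h := coeff_monomial_mul (m.degree g) β (coeff α f) g
          rwa [add_comm, ← hβ] at h
        rw [coeff_sub, coeff_smul, this, smul_eq_mul, mul_comm, sub_self])
    refine ⟨s * m.leadingCoeff g, M.mul_mem hs (hM g hg), r, h1, h2, ?_⟩
    have := J.add_mem h3 (J.mul_mem_left (s • monomial β (coeff α f)) (hG hg))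
    convert this using 1
    simp only [smul_sub, mul_smul, smul_mul_assoc]
    ring
  -- The exponent `α` is standard: its term goes to the remainder, multiplied by the scalar that
  -- reduces the rest.
  · obtain ⟨s, hs, r, h1, h2, h3⟩ := lower (f - monomial α (coeff α f)) (by
      intro c hc
      rw [mem_support_iff, coeff_sub, coeff_monomial] at hc
      by_cases h : α = c
      · subst h; simp at hc
      · rw [if_neg h, sub_zero] at hc
        refine lt_of_le_of_ne (hf c (mem_support_iff.mpr hc)) ?_
        rw [← ha]
        exact fun h' => h (m.toSyn.injective h').symm)
    refine ⟨s, hs, r + s • monomial α (coeff α f), ?_, ?_, ?_⟩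
    · intro c hc
      rcases Finset.mem_union.mp (support_add hc) with hc | hc
      · exact h1 c hc
      · have : c = α := by
          have := support_smul hc
          simpa using support_monomial_subset this
        subst this
        intro g hg hle
        exact hstd ⟨g, hg, hle⟩
    · intro c hc
      rcases Finset.mem_union.mp (support_add hc) with hc | hc
      · exact h2 c hc
      · have : c = α := by
          have := support_smul hc
          simpa using support_monomial_subset this
        subst this
        exact ha.le
    · convert h3 using 1
      rw [smul_sub]; ring

open scoped MonomialOrder in
/-- A polynomial ideal over a domain has finitely many elements whose leading exponents generate
all leading exponents. -/
theorem exists_finset_leading {S σ : Type*} [CommRing S] [Finite σ]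
    (m : MonomialOrder σ) (J : Ideal (MvPolynomial σ S)) :
    ∃ G : Finset (MvPolynomial σ S), (∀ g ∈ G, g ∈ J ∧ g ≠ 0) ∧
      ∀ h ∈ J, h ≠ 0 → ∃ g ∈ G, m.degree g ≤ m.degree h := by
  classical
  set E : Set (σ →₀ ℕ) := {c | ∃ h ∈ J, h ≠ 0 ∧ m.degree h = c} with hE
  -- Dickson's lemma: an antichain of exponents in finitely many variables is finite. No chain
  -- condition on `S` is involved.
  have hpwo : E.IsPWO := Set.isPWO_of_wellQuasiOrderedLE E
  have hfin : {c | Minimal (· ∈ E) c}.Finite :=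
    (setOfPred_minimal_antichain _).finite_of_partiallyWellOrderedOn
      (hpwo.mono (setOfPred_minimal_subset _))
  have hc : ∀ c : {c | Minimal (· ∈ E) c}, ∃ h ∈ J, h ≠ 0 ∧ m.degree h = c := fun c => c.2.1
  choose g hgJ hg0 hgd using hc
  have := hfin.fintype
  refine ⟨Finset.univ.image g, ?_, ?_⟩
  · intro h hh
    obtain ⟨c, -, rfl⟩ := Finset.mem_image.mp hh
    exact ⟨hgJ c, hg0 c⟩
  · intro h hh h0
    obtain ⟨z, hz, hz'⟩ := hpwo.exists_le_minimal (show m.degree h ∈ E from ⟨h, hh, h0, rfl⟩)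
    exact ⟨g ⟨z, hz'⟩, Finset.mem_image_of_mem _ (Finset.mem_univ _), by rw [hgd]; exact hz⟩

/-- The extension of an ideal along a change of coefficients is spanned as a module over the
coefficients by the images of the elements of the ideal. -/
theorem mem_span_image_of_mem_map {S L σ : Type*} [CommRing S] [CommRing L] (p : S →+* L)
    (J : Ideal (MvPolynomial σ S)) {f : MvPolynomial σ L} (hf : f ∈ J.map (map p)) :
    f ∈ Submodule.span L (map p '' (J : Set (MvPolynomial σ S))) := by
  have key : ∀ (a : MvPolynomial σ L), ∀ h ∈ J,
      a * map p h ∈ Submodule.span L (map p '' (J : Set (MvPolynomial σ S))) := by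
    intro a h hh
    rw [a.as_sum, Finset.sum_mul]
    refine Submodule.sum_mem _ fun c _ => ?_
    have : monomial c (coeff c a) * map p h = coeff c a • map p (monomial c 1 * h) := by
      rw [map_mul, map_monomial, map_one, smul_eq_C_mul, ← mul_assoc, C_mul_monomial, mul_one]
    rw [this]
    exact Submodule.smul_mem _ _ (Submodule.subset_span ⟨_, J.mul_mem_left _ hh, rfl⟩)
  obtain ⟨n, a, h, rfl⟩ := Submodule.mem_span_set'.mp hf
  refine Submodule.sum_mem _ fun i _ => ?_
  obtain ⟨g, hg, hgi⟩ := (h i).2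
  rw [← hgi]
  exact key _ g hg

open scoped MonomialOrder in
/-- Generic freeness of `S[x] / J` for a domain `S`: away from the zeros of some `F ≠ 0`, a fixed
set `B` of monomials is a basis modulo all specializations of `J`. It is described by the normal
form `ρ`, which moreover does not raise the total degree. -/
theorem exists_generic_normalForm {S σ : Type*} [CommRing S] [IsDomain S] [LinearOrder σ]
    [Finite σ] (J : Ideal (MvPolynomial σ S)) :
    ∃ (F : S) (B : Set (σ →₀ ℕ)), F ≠ 0 ∧ ∀ (L : Type*) [Field L] (p : S →+* L), p F ≠ 0 →
      ∃ ρ : MvPolynomial σ L →ₗ[L] MvPolynomial σ L,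
        (∀ f, ρ f = 0 ↔ f ∈ J.map (map p)) ∧ (∀ f, ∀ c ∈ (ρ f).support, c ∈ B) ∧
        (∀ b ∈ B, ρ (monomial b 1) = monomial b 1) ∧
        ∀ f, (ρ f).totalDegree ≤ f.totalDegree := by
  classical
  -- A graded order, so that a remainder never has larger total degree than the monomial it
  -- replaces.
  set m : MonomialOrder σ := MonomialOrder.degLex
  obtain ⟨G, hG, hlead⟩ := exists_finset_leading m J
  set M : Submonoid S := Submonoid.closure (m.leadingCoeff '' (G : Set (MvPolynomial σ S)))
  set B : Set (σ →₀ ℕ) := {c | ∀ g ∈ G, ¬ m.degree g ≤ c} with hB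
  have hBJ : ∀ f ∈ J, (∀ c ∈ f.support, c ∈ B) → f = 0 := by
    intro f hf hfB
    by_contra h0
    obtain ⟨g, hg, hle⟩ := hlead f hf h0
    exact hfB _ (m.degree_mem_support h0) g hg hle
  have hnf : ∀ c : σ →₀ ℕ, ∃ s ∈ M, ∃ r : MvPolynomial σ S, (∀ c ∈ r.support, c ∈ B) ∧
      (∀ e ∈ r.support, m.toSyn e ≤ m.toSyn c) ∧ s • monomial c 1 - r ∈ J := by
    intro c
    refine exists_pseudo_normalForm m J G (fun g hg => (hG g hg).1) M
      (fun g hg => Submonoid.subset_closure ⟨g, hg, rfl⟩) _ _ ?_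
    intro e he
    have : e = c := by simpa using support_monomial_subset he
    rw [this]
  choose s hs r hrB hrd hrJ using hnf
  -- With `F` the product of the leading coefficients, `p F ≠ 0` makes every scalar used in
  -- pseudo-division invertible in `L`.
  refine ⟨∏ g ∈ G, m.leadingCoeff g, B, ?_, ?_⟩
  · rw [Finset.prod_ne_zero_iff]
    exact fun g hg => m.leadingCoeff_ne_zero_iff.mpr (hG g hg).2
  intro L _ p hp
  have hpM : ∀ a ∈ M, p a ≠ 0 := by
    intro a ha
    induction ha using Submonoid.closure_induction with
    | mem x hx =>
      obtain ⟨g, hg, rfl⟩ := hx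
      rw [map_prod, Finset.prod_ne_zero_iff] at hp
      exact hp g hg
    | one => simp
    | mul x y _ _ hx hy => rw [map_mul]; exact mul_ne_zero hx hy
  have hps : ∀ c, p (s c) ≠ 0 := fun c => hpM _ (hs c)
  set ρ : MvPolynomial σ L →ₗ[L] MvPolynomial σ L :=
    (basisMonomials σ L).constr L fun c => (p (s c))⁻¹ • map p (r c) with hρ
  have hρm : ∀ c, ρ (monomial c 1) = (p (s c))⁻¹ • map p (r c) := by
    intro c
    have := (basisMonomials σ L).constr_basis L (fun c => (p (s c))⁻¹ • map p (r c)) c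
    rwa [coe_basisMonomials] at this
  have hρm' : ∀ c a, ρ (monomial c a) = (a * (p (s c))⁻¹) • map p (r c) := by
    intro c a
    have : monomial c a = a • monomial c (1 : L) := by simp [smul_monomial]
    rw [this, map_smul, hρm, smul_smul]
  have hmapsupp : ∀ f : MvPolynomial σ S, (map p f).support ⊆ f.support :=
    fun f => support_map_subset p f
  have hρB : ∀ f, ∀ c ∈ (ρ f).support, c ∈ B := by
    intro f
    rw [f.as_sum, map_sum]
    intro c hc
    obtain ⟨e, -, he⟩ := Finset.mem_biUnion.mp (support_sum hc)
    rw [hρm'] at he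
    exact hrB e c (hmapsupp _ (support_smul he))
  have hsub : ∀ f, f - ρ f ∈ J.map (map p) := by
    intro f
    induction f using MvPolynomial.induction_on' with
    | monomial c a =>
      have h1 := Ideal.mem_map_of_mem (map p) (hrJ c)
      have h2 := (J.map (map p)).mul_mem_left (C (a * (p (s c))⁻¹)) h1
      convert h2 using 1
      rw [hρm', map_sub, mul_sub, smul_eq_C_mul, smul_eq_C_mul, map_mul (map p),
        MvPolynomial.map_C, map_monomial,
        map_one, ← mul_assoc, ← C_mul, mul_assoc, inv_mul_cancel₀ (hps c), mul_one,
        C_mul_monomial, mul_one]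
    | add f g hf hg =>
      rw [map_add, add_sub_add_comm]
      exact Ideal.add_mem _ hf hg
  -- Denominators are cleared over `S`: the combination `q` of remainders lies in `J` and has only
  -- standard exponents, so it is zero already before specialization. Thus `p` need not be
  -- injective.
  have hρJ : ∀ h ∈ J, ρ (map p h) = 0 := by
    intro h hh
    set d := ∏ c ∈ h.support, s c
    have hdM : d ∈ M := Submonoid.prod_mem _ fun c _ => hs c
    have hfac : ∀ c ∈ h.support, (∏ e ∈ h.support.erase c, s e) * s c = d := fun c hc =>
      Finset.prod_erase_mul _ _ hc
    set q : MvPolynomial σ S :=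
      ∑ c ∈ h.support, (coeff c h * ∏ e ∈ h.support.erase c, s e) • r c with hq
    have hqJ : q ∈ J := by
      have h1 : d • h - q ∈ J := by
        have : d • h - q = ∑ c ∈ h.support, C (coeff c h * ∏ e ∈ h.support.erase c, s e) *
            (s c • monomial c 1 - r c) := by
          rw [hq]
          have h2 : d • h = ∑ c ∈ h.support, d • monomial c (coeff c h) := by
            rw [← Finset.smul_sum, ← h.as_sum]
          rw [h2, ← Finset.sum_sub_distrib]
          refine Finset.sum_congr rfl fun c hc => ?_
          rw [mul_sub, ← smul_eq_C_mul, ← smul_eq_C_mul, smul_smul, mul_assoc, hfac c hc,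
            smul_monomial, smul_monomial, smul_eq_mul, smul_eq_mul, mul_one, mul_comm d]
        rw [this]
        exact J.sum_mem fun c _ => J.mul_mem_left _ (hrJ c)
      have h2 := J.sub_mem (Submodule.smul_of_tower_mem J d hh) h1
      rwa [sub_sub_cancel] at h2
    have hq0 : q = 0 := by
      refine hBJ q hqJ ?_
      intro c hc
      obtain ⟨e, -, he⟩ := Finset.mem_biUnion.mp (support_sum hc)
      exact hrB e c (support_smul he)
    have h3 : p d • ρ (map p h) = map p q := by
      conv_lhs => rw [h.as_sum, map_sum, map_sum, Finset.smul_sum]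
      rw [hq, map_sum]
      refine Finset.sum_congr rfl ?_
      intro c hc
      rw [map_monomial, hρm', smul_smul, smul_eq_C_mul, smul_eq_C_mul, map_mul (map p),
        MvPolynomial.map_C, ← hfac c hc]
      congr 2
      rw [map_mul, map_mul]
      field_simp [hps c]
    rw [hq0, map_zero] at h3
    exact (smul_eq_zero.mp h3).resolve_left (hpM d hdM)
  refine ⟨ρ, ?_, hρB, ?_, ?_⟩
  · intro f
    constructor
    · intro h
      have := hsub f
      rwa [h, sub_zero] at this
    · intro h
      replace h := mem_span_image_of_mem_map p J h
      induction h using Submodule.span_induction with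
      | mem x hx => obtain ⟨h, hh, rfl⟩ := hx; exact hρJ h hh
      | zero => simp
      | add x y _ _ hx hy => rw [map_add, hx, hy, add_zero]
      | smul b x _ hx => rw [map_smul, hx, smul_zero]
  · intro b hb
    have h1 := hrJ b
    have h2 : s b • monomial b (1 : S) - r b = 0 := by
      refine hBJ _ h1 ?_
      intro c hc
      rcases Finset.mem_union.mp (support_sub _ _ _ hc) with hc | hc
      · have : c = b := by
          have := support_smul hc
          simpa using support_monomial_subset this
        rwa [this]
      · exact hrB b c hc
    rw [hρm, ← sub_eq_zero.mp h2, smul_monomial, smul_eq_mul, mul_one, map_monomial,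
      smul_monomial, smul_eq_mul, inv_mul_cancel₀ (hps b)]
  · intro f
    refine Finset.sup_le fun c hc => ?_
    have hc' : c ∈ (∑ e ∈ f.support, ρ (monomial e (coeff e f))).support := by
      rwa [← map_sum, ← f.as_sum]
    obtain ⟨e, he, hce⟩ := Finset.mem_biUnion.mp (support_sum hc')
    rw [hρm'] at hce
    have h1 := hrd e c (hmapsupp _ (support_smul hce))
    exact (Finsupp.DegLex.monotone_degree h1).trans (le_totalDegree he)

/-! ### Degree filtrations and multiplication by a linear form. -/

theorem finrank_map_add_finrank_inf_ker {L V W : Type*} [Field L] [AddCommGroup V] [Module L V]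
    [AddCommGroup W] [Module L W] (f : V →ₗ[L] W) (U : Submodule L V) [FiniteDimensional L U] :
    Module.finrank L (U.map f) + Module.finrank L (U ⊓ LinearMap.ker f : Submodule L V) =
      Module.finrank L U := by
  rw [← LinearMap.finrank_range_add_finrank_ker (f.domRestrict U), LinearMap.range_domRestrict,
    LinearMap.ker_domRestrict]
  congr 1
  rw [← Submodule.finrank_map_subtype_eq U (Submodule.comap U.subtype (LinearMap.ker f)),
    Submodule.map_comap_subtype]

section Filtration

variable {L σ : Type*} [Field L]

/-- The residue classes modulo `J` of the polynomials of total degree at most `D`. -/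
noncomputable def degreeFiltration (J : Ideal (MvPolynomial σ L)) (D : ℕ) :
    Submodule L (MvPolynomial σ L ⧸ J) :=
  (restrictTotalDegree σ L D).map (Ideal.Quotient.mkₐ L J).toLinearMap

/-- The kernel of the multiplication by `z` on the residue class ring of `J`. -/
noncomputable def mulKer (J : Ideal (MvPolynomial σ L)) (z : MvPolynomial σ L) :
    Submodule L (MvPolynomial σ L ⧸ J) :=
  LinearMap.ker (LinearMap.mulLeft L (Ideal.Quotient.mk J z))

theorem mk_mem_mulKer {J : Ideal (MvPolynomial σ L)} {z f : MvPolynomial σ L} :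
    Ideal.Quotient.mk J f ∈ mulKer J z ↔ z * f ∈ J := by
  rw [mulKer, LinearMap.mem_ker, LinearMap.mulLeft_apply, ← map_mul, Ideal.Quotient.eq_zero_iff_mem]

theorem mem_degreeFiltration {J : Ideal (MvPolynomial σ L)} {D : ℕ} {x : MvPolynomial σ L ⧸ J} :
    x ∈ degreeFiltration J D ↔ ∃ f : MvPolynomial σ L, f.totalDegree ≤ D ∧
      Ideal.Quotient.mk J f = x := by
  simp only [degreeFiltration, Submodule.mem_map, mem_restrictTotalDegree]
  rfl

instance [Finite σ] (J : Ideal (MvPolynomial σ L)) (D : ℕ) :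
    FiniteDimensional L (degreeFiltration J D) := by
  rw [degreeFiltration]
  infer_instance

theorem degreeFiltration_mono (J : Ideal (MvPolynomial σ L)) : Monotone (degreeFiltration J) := by
  intro D E h x hx
  obtain ⟨f, hf, rfl⟩ := mem_degreeFiltration.mp hx
  exact mem_degreeFiltration.mpr ⟨f, hf.trans h, rfl⟩

/-- Reduction modulo `J` and `ρ` have the same kernel, so it suffices to measure the image under `ρ`
of the polynomials of degree at most `D`. As `ρ` fixes standard monomials and does not raise
degrees, they span that image. The count involves `B` only, hence is the same for all
specializations. -/
theorem finrank_degreeFiltration [Finite σ] (J : Ideal (MvPolynomial σ L)) (B : Set (σ →₀ ℕ))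
    (ρ : MvPolynomial σ L →ₗ[L] MvPolynomial σ L) (hρ : ∀ f, ρ f = 0 ↔ f ∈ J)
    (hB : ∀ f, ∀ c ∈ (ρ f).support, c ∈ B) (hB' : ∀ b ∈ B, ρ (monomial b 1) = monomial b 1)
    (hdeg : ∀ f, (ρ f).totalDegree ≤ f.totalDegree) (D : ℕ) :
    Module.finrank L (degreeFiltration J D) = Nat.card {b | b ∈ B ∧ b.degree ≤ D} := by
  have hker : LinearMap.ker (Ideal.Quotient.mkₐ L J).toLinearMap = LinearMap.ker ρ := by
    ext f
    rw [LinearMap.mem_ker, LinearMap.mem_ker, hρ]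
    exact Ideal.Quotient.eq_zero_iff_mem
  have h1 := finrank_map_add_finrank_inf_ker (Ideal.Quotient.mkₐ L J).toLinearMap
    (restrictTotalDegree σ L D)
  have h2 := finrank_map_add_finrank_inf_ker ρ (restrictTotalDegree σ L D)
  rw [hker] at h1
  have h3 : (restrictTotalDegree σ L D).map ρ = restrictSupport L {b | b ∈ B ∧ b.degree ≤ D} := by
    apply le_antisymm
    · rintro _ ⟨f, hf, rfl⟩
      rw [mem_restrictSupport_iff]
      intro c hc
      exact ⟨hB f c hc, (le_totalDegree hc).trans
        ((hdeg f).trans ((mem_restrictTotalDegree σ D f).mp hf))⟩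
    · rw [restrictSupport_eq_span, Submodule.span_le]
      rintro _ ⟨b, hb, rfl⟩
      refine ⟨monomial b 1, ?_, hB' b hb.1⟩
      rw [SetLike.mem_coe, mem_restrictTotalDegree, totalDegree_monomial _ one_ne_zero]
      exact hb.2
  rw [h3, Module.finrank_eq_nat_card_basis (basisRestrictSupport L _)] at h2
  rw [degreeFiltration]
  omega

theorem homogeneousComponent_succ_mul {z : MvPolynomial σ L} (hz : z.IsHomogeneous 1)
    (f : MvPolynomial σ L) (i : ℕ) :
    homogeneousComponent (i + 1) (z * f) = z * homogeneousComponent i f := by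
  conv_lhs => rw [← sum_homogeneousComponent f, Finset.mul_sum, map_sum]
  have h : ∀ j, homogeneousComponent (i + 1) (z * homogeneousComponent j f) =
      if j = i then z * homogeneousComponent j f else 0 := by
    intro j
    have := homogeneousComponent_of_mem (m := i + 1)
      (hz.mul (homogeneousComponent_isHomogeneous j f))
    rw [this]
    congr 1
    simp only [eq_iff_iff]
    omega
  simp only [h, Finset.sum_ite_eq', Finset.mem_range]
  split_ifs with h'
  · rfl
  · rw [homogeneousComponent_eq_zero _ _ (by omega), mul_zero]

theorem homogeneousComponent_zero_mul {z : MvPolynomial σ L} (hz : z.IsHomogeneous 1)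
    (f : MvPolynomial σ L) : homogeneousComponent 0 (z * f) = 0 := by
  rw [← sum_homogeneousComponent f, Finset.mul_sum, map_sum]
  refine Finset.sum_eq_zero fun j _ => ?_
  rw [homogeneousComponent_of_mem (hz.mul (homogeneousComponent_isHomogeneous j f)), if_neg]
  omega

/-- Rank count for the multiplication by a linear form on the degree filtration. -/
theorem finrank_mulKer_inf_degreeFiltration [Finite σ] {J : Ideal (MvPolynomial σ L)}
    (hJ : J.IsHomogeneous (homogeneousSubmodule σ L)) {z : MvPolynomial σ L}
    (hz : z.IsHomogeneous 1) (D : ℕ) :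
    Module.finrank L (degreeFiltration J D ⊓ mulKer J z : Submodule L _) +
        Module.finrank L (degreeFiltration J (D + 1)) =
      Module.finrank L (degreeFiltration J D) +
        Module.finrank L (degreeFiltration (J ⊔ Ideal.span {z}) (D + 1)) := by
  set π : (MvPolynomial σ L ⧸ J) →ₗ[L] (MvPolynomial σ L ⧸ (J ⊔ Ideal.span {z})) :=
    (Ideal.Quotient.factorₐ L (le_sup_left : J ≤ J ⊔ Ideal.span {z})).toLinearMap with hπ
  have hπmk : ∀ f, π (Ideal.Quotient.mk J f) = Ideal.Quotient.mk _ f := fun f => rfl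
  have h1 := finrank_map_add_finrank_inf_ker (LinearMap.mulLeft L (Ideal.Quotient.mk J z))
    (degreeFiltration J D)
  have h2 := finrank_map_add_finrank_inf_ker π (degreeFiltration J (D + 1))
  have h3 : (degreeFiltration J (D + 1)).map π = degreeFiltration (J ⊔ Ideal.span {z}) (D + 1) := by
    rw [degreeFiltration, degreeFiltration, ← Submodule.map_comp]
    rfl
  -- Exactness in the middle of `ker z → F_D → F_{D+1} → F_{D+1}` modulo `z`; this is where the
  -- grading matters.
  have h4 : (degreeFiltration J D).map (LinearMap.mulLeft L (Ideal.Quotient.mk J z)) =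
      degreeFiltration J (D + 1) ⊓ LinearMap.ker π := by
    apply le_antisymm
    · rintro _ ⟨x, hx, rfl⟩
      obtain ⟨f, hf, rfl⟩ := mem_degreeFiltration.mp hx
      rw [LinearMap.mulLeft_apply, ← map_mul]
      refine ⟨mem_degreeFiltration.mpr ⟨z * f, ?_, rfl⟩, ?_⟩
      · have := totalDegree_mul z f
        have := hz.totalDegree_le
        omega
      · rw [SetLike.mem_coe, LinearMap.mem_ker, hπmk, Ideal.Quotient.eq_zero_iff_mem]
        exact Ideal.mul_mem_right _ _ (Ideal.mem_sup_right (Ideal.mem_span_singleton_self z))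
    · rintro x ⟨hx, hxπ⟩
      obtain ⟨u, hu, rfl⟩ := mem_degreeFiltration.mp hx
      rw [SetLike.mem_coe, LinearMap.mem_ker, hπmk, Ideal.Quotient.eq_zero_iff_mem,
        Submodule.mem_sup] at hxπ
      obtain ⟨j, hj, y, hy, hjy⟩ := hxπ
      obtain ⟨f, rfl⟩ := Ideal.mem_span_singleton'.mp hy
      -- In `u = j + f z` the factor `f` may have large degree; since `u` has degree at most `D +
      -- 1`, the components of `f` above degree `D` contribute only elements of `J`.
      refine ⟨Ideal.Quotient.mk J (∑ i ∈ Finset.range (D + 1), homogeneousComponent i f),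
        mem_degreeFiltration.mpr ⟨_, ?_, rfl⟩, ?_⟩
      · refine totalDegree_finsetSum_le fun i hi => ?_
        have := (homogeneousComponent_isHomogeneous i f).totalDegree_le
        have := Finset.mem_range.mp hi
        omega
      · rw [LinearMap.mulLeft_apply, ← map_mul, Ideal.Quotient.eq,
          mem_iff_homogeneousComponent_mem hJ]
        have htrunc : ∀ i, homogeneousComponent i
            (∑ i ∈ Finset.range (D + 1), homogeneousComponent i f) =
            if i ∈ Finset.range (D + 1) then homogeneousComponent i f else 0 := by
          intro i
          rw [map_sum]
          have : ∀ j, homogeneousComponent i (homogeneousComponent j f) =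
              if j = i then homogeneousComponent j f else 0 := by
            intro j
            rw [homogeneousComponent_of_mem (homogeneousComponent_mem j f)]
            congr 1
            simp only [eq_iff_iff]
            omega
          simp only [this, Finset.sum_ite_eq']
        intro e
        rw [map_sub]
        have hje := homogeneousComponent_mem_of_mem hJ hj e
        have hju : homogeneousComponent e u =
            homogeneousComponent e j + homogeneousComponent e (z * f) := by
          rw [← hjy, map_add, mul_comm f z]
        rcases e with _ | e
        · rw [homogeneousComponent_zero_mul hz] at hju ⊢
          rw [hju, zero_sub, add_zero]
          exact J.neg_mem hje
        · rw [homogeneousComponent_succ_mul hz] at hju ⊢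
          rw [htrunc]
          split_ifs with h
          · rw [hju, sub_add_cancel_right]
            exact J.neg_mem hje
          · rw [Finset.mem_range] at h
            rw [homogeneousComponent_eq_zero (e + 1) u (by omega), mul_zero, sub_zero]
            exact J.zero_mem
  rw [h3] at h2
  rw [h4] at h1
  change _ + Module.finrank L (degreeFiltration J D ⊓ mulKer J z : Submodule L _) = _ at h1
  omega

theorem exists_degreeFiltration_ge (J : Ideal (MvPolynomial σ L))
    (N : Submodule L (MvPolynomial σ L ⧸ J)) (hN : N.FG) : ∃ D, N ≤ degreeFiltration J D := by
  classical
  obtain ⟨s, rfl⟩ := hN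
  induction s using Finset.induction_on with
  | empty => exact ⟨0, by simp⟩
  | insert x s _ ih =>
    obtain ⟨D, hD⟩ := ih
    obtain ⟨f, rfl⟩ := Ideal.Quotient.mk_surjective x
    refine ⟨max D f.totalDegree, ?_⟩
    rw [Finset.coe_insert, Submodule.span_insert, sup_le_iff]
    refine ⟨?_, hD.trans (degreeFiltration_mono J (le_max_left _ _))⟩
    rw [Submodule.span_singleton_le_iff_mem]
    exact mem_degreeFiltration.mpr ⟨f, le_max_right _ _, rfl⟩

/-- The intersections with `N` stop growing at `D`, and the filtration exhausts the quotient. Finite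
dimension of `N` is a conclusion here: it is how finiteness passes from one point of a family to the
others. -/
theorem le_degreeFiltration_of_finrank_eq [Finite σ] (J : Ideal (MvPolynomial σ L))
    (N : Submodule L (MvPolynomial σ L ⧸ J)) (D r : ℕ)
    (h : ∀ E, D ≤ E → Module.finrank L (degreeFiltration J E ⊓ N : Submodule L _) = r) :
    N ≤ degreeFiltration J D ∧ Module.finrank L N = r := by
  have hle : N ≤ degreeFiltration J D := by
    intro x hx
    obtain ⟨f, rfl⟩ := Ideal.Quotient.mk_surjective x
    set E := max D f.totalDegree
    have h1 : degreeFiltration J D ⊓ N ≤ degreeFiltration J E ⊓ N :=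
      inf_le_inf_right _ (degreeFiltration_mono J (le_max_left _ _))
    have h2 := Submodule.eq_of_le_of_finrank_eq h1 (by rw [h D le_rfl, h E (le_max_left _ _)])
    have h3 : Ideal.Quotient.mk J f ∈ degreeFiltration J E ⊓ N :=
      ⟨mem_degreeFiltration.mpr ⟨f, le_max_right _ _, rfl⟩, hx⟩
    rw [← h2] at h3
    exact h3.1
  exact ⟨hle, by rw [← h D le_rfl, inf_eq_right.mpr hle]⟩

/-- If the kernel of the multiplication by a linear form on a graded residue class ring is bounded
in degree, then it is annihilated by a power of the graded maximal ideal. -/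
theorem mul_mem_of_mulKer_le_degreeFiltration {J : Ideal (MvPolynomial σ L)}
    (hJ : J.IsHomogeneous (homogeneousSubmodule σ L)) {z : MvPolynomial σ L}
    (hz : z.IsHomogeneous 1) {D : ℕ} (hD : mulKer J z ≤ degreeFiltration J D)
    {g f : MvPolynomial σ L} (hg : g ∈ idealOfVars σ L ^ (D + 1)) (hf : z * f ∈ J) :
    g * f ∈ J := by
  have hfi : ∀ i, z * homogeneousComponent i f ∈ J := fun i => by
    rw [← homogeneousComponent_succ_mul hz]
    exact homogeneousComponent_mem_of_mem hJ hf _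
  have key : ∀ e i, D < e → homogeneousComponent e g * homogeneousComponent i f ∈ J := by
    intro e i he
    have h1 : Ideal.Quotient.mk J (homogeneousComponent e g * homogeneousComponent i f) ∈
        mulKer J z := by
      rw [mk_mem_mulKer, mul_left_comm]
      exact J.mul_mem_left _ (hfi i)
    -- The product is homogeneous of degree `e + i > D` but congruent to some `u` of degree at most
    -- `D`; comparing components in degree `e + i` puts it in `J`.
    obtain ⟨u, hu, hue⟩ := mem_degreeFiltration.mp (hD h1)
    rw [Ideal.Quotient.eq] at hue
    have h2 := homogeneousComponent_mem_of_mem hJ hue (e + i)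
    rw [map_sub, homogeneousComponent_eq_zero (e + i) u (by omega),
      homogeneousComponent_eq_self ((homogeneousComponent_isHomogeneous e g).mul
        (homogeneousComponent_isHomogeneous i f)), zero_sub] at h2
    exact J.neg_mem_iff.mp h2
  rw [mem_pow_idealOfVars_iff'] at hg
  rw [← sum_homogeneousComponent g, ← sum_homogeneousComponent f, Finset.sum_mul_sum]
  refine J.sum_mem fun e _ => J.sum_mem fun i _ => ?_
  by_cases he : D < e
  · exact key e i he
  · have : homogeneousComponent e g = 0 := by
      ext c
      rw [coeff_homogeneousComponent]
      split_ifs with hc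
      · rw [hg c (by omega), coeff_zero]
      · rw [coeff_zero]
    rw [this, zero_mul]
    exact J.zero_mem

end Filtration

/-- For a family of graded ideals and linear forms over a domain `S`, the kernel of the
multiplication by the linear form has a generic Hilbert function. -/
theorem exists_generic_finrank_mulKer {S σ : Type*} [CommRing S] [IsDomain S] [LinearOrder σ]
    [Finite σ] (J : Ideal (MvPolynomial σ S)) (w : MvPolynomial σ S) :
    ∃ (F : S) (u : ℕ → ℕ), F ≠ 0 ∧ ∀ (L : Type*) [Field L] (p : S →+* L), p F ≠ 0 →
      (J.map (map p)).IsHomogeneous (homogeneousSubmodule σ L) → (map p w).IsHomogeneous 1 →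
      ∀ D, Module.finrank L (degreeFiltration (J.map (map p)) D ⊓
        mulKer (J.map (map p)) (map p w) : Submodule L _) = u D := by
  obtain ⟨F, B, hF, h⟩ := exists_generic_normalForm J
  obtain ⟨F', B', hF', h'⟩ := exists_generic_normalForm (J ⊔ Ideal.span {w})
  -- The value dictated by the rank count, from the Hilbert functions of `J` and `J + (w)`; by the
  -- same count the natural subtraction does not truncate.
  refine ⟨F * F', fun D => Nat.card {b | b ∈ B ∧ b.degree ≤ D} +
    Nat.card {b | b ∈ B' ∧ b.degree ≤ D + 1} - Nat.card {b | b ∈ B ∧ b.degree ≤ D + 1},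
    mul_ne_zero hF hF', ?_⟩
  intro L _ p hp hJ hw D
  rw [map_mul] at hp
  obtain ⟨ρ, h1, h2, h3, h4⟩ := h L p (left_ne_zero_of_mul hp)
  obtain ⟨ρ', h1', h2', h3', h4'⟩ := h' L p (right_ne_zero_of_mul hp)
  have e1 := finrank_degreeFiltration _ B ρ h1 h2 h3 h4 D
  have e2 := finrank_degreeFiltration _ B ρ h1 h2 h3 h4 (D + 1)
  have e3 := finrank_degreeFiltration _ B' ρ' h1' h2' h3' h4' (D + 1)
  rw [Ideal.map_sup, Ideal.map_span, Set.image_singleton] at e3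
  have e4 := finrank_mulKer_inf_degreeFiltration hJ hw D
  dsimp only
  omega

/-! ### Lengths over the localization as dimensions over `K(X)`. -/

theorem colonLength_eq_length_torsionBy {A : Type*} [CommRing A] (J : Ideal A) (z : A) :
    colonLength J z = Module.length A (Submodule.torsionBy A (A ⧸ J) z) := by
  set φ : J.colon {z} →ₗ[A] Submodule.torsionBy A (A ⧸ J) z :=
    ((Submodule.mkQ J).comp (J.colon {z}).subtype).codRestrict _ (by
      rintro ⟨f, hf⟩
      rw [Submodule.mem_torsionBy_iff]
      rw [Submodule.mem_colon_singleton] at hf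
      change z • Submodule.Quotient.mk f = 0
      rw [← Submodule.Quotient.mk_smul, Submodule.Quotient.mk_eq_zero, smul_eq_mul, mul_comm]
      exact hf) with hφ
  have hsurj : Function.Surjective φ := by
    rintro ⟨x, hx⟩
    obtain ⟨f, rfl⟩ := Submodule.Quotient.mk_surjective J x
    rw [Submodule.mem_torsionBy_iff, ← Submodule.Quotient.mk_smul, Submodule.Quotient.mk_eq_zero,
      smul_eq_mul, mul_comm] at hx
    exact ⟨⟨f, Submodule.mem_colon_singleton.mpr hx⟩, rfl⟩
  have hker : J.submoduleOf (J.colon {z}) = LinearMap.ker φ := by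
    rw [hφ, LinearMap.ker_codRestrict, LinearMap.ker_comp, Submodule.ker_mkQ]
    rfl
  rw [colonLength]
  exact ((Submodule.quotEquivOfEq _ _ hker).trans (φ.quotKerEquivOfSurjective hsurj)).length_eq

/-- If `A` is the sum of a field `L` and an ideal `P`, then the length of a module annihilated by
a power of `P` is its dimension over `L`. -/
theorem length_eq_of_coefficientField {L A : Type*} [Field L] [CommRing A] [Algebra L A]
    (P : Ideal A) (hP : ∀ a, ∃ c : L, a - algebraMap L A c ∈ P) (k : ℕ) :
    ∀ (M : Type*) [AddCommGroup M] [Module A M] [Module L M] [IsScalarTower L A M],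
      (∀ a ∈ P ^ k, ∀ x : M, a • x = 0) → Module.length A M = Module.length L M := by
  induction k with
  | zero =>
    intro M _ _ _ _ h
    have : Subsingleton M := ⟨fun x y => by
      have hx := h 1 (by simp) x
      have hy := h 1 (by simp) y
      rw [one_smul] at hx hy
      rw [hx, hy]⟩
    rw [Module.length_eq_zero, Module.length_eq_zero]
  | succ k ih =>
    intro M _ _ _ _ h
    -- Devissage along `P • M`: the quotient is a module over `A ⧸ P`, onto which `L` surjects, and
    -- `P • M` itself is annihilated by `P ^ k`.
    set N : Submodule A M := P • ⊤ with hN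
    have hsurj : Function.Surjective (algebraMap L (A ⧸ P)) := by
      intro a
      obtain ⟨a, rfl⟩ := Ideal.Quotient.mk_surjective a
      obtain ⟨c, hc⟩ := hP a
      refine ⟨c, ?_⟩
      rw [IsScalarTower.algebraMap_apply L A (A ⧸ P)]
      exact (Ideal.Quotient.eq.mpr hc).symm
    have hq : Module.length A (M ⧸ N) = Module.length L (M ⧸ N) := by
      have : IsScalarTower L (A ⧸ P) (M ⧸ N) := by
        refine ⟨fun c a x => ?_⟩
        obtain ⟨a, rfl⟩ := Ideal.Quotient.mk_surjective a
        obtain ⟨x, rfl⟩ := Submodule.Quotient.mk_surjective _ x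
        change Submodule.Quotient.mk ((c • a) • x) = c • Submodule.Quotient.mk (a • x)
        rw [smul_assoc, Submodule.Quotient.mk_smul]
      rw [Module.length_eq_of_surjective (R := A ⧸ P) (S := L) hsurj]
      exact Module.length_eq_of_surjective (R := A ⧸ P) (S := A) Ideal.Quotient.mk_surjective
    have hn : Module.length A N = Module.length L N := by
      refine ih N fun a ha x => ?_
      obtain ⟨x, hx⟩ := x
      rw [Subtype.ext_iff]
      change a • x = 0
      rw [hN] at hx
      induction hx using Submodule.smul_induction_on' with
      | smul r hr m hm =>
        rw [smul_smul]
        exact h _ (by rw [pow_succ]; exact Ideal.mul_mem_mul ha hr) m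
      | add x _ y _ hx hy => rw [smul_add, hx, hy, add_zero]
    rw [Module.length_eq_add_of_exact N.subtype N.mkQ N.subtype_injective N.mkQ_surjective
      (LinearMap.exact_subtype_mkQ N),
      Module.length_eq_add_of_exact (N.subtype.restrictScalars L) (N.mkQ.restrictScalars L)
        N.subtype_injective N.mkQ_surjective (LinearMap.exact_subtype_mkQ N), hq, hn]

/-- Let `A` be the sum of a domain `C` and a prime ideal `P` with `C ∩ P = 0`, and let `D` be the
localization of `A ⧸ J` that inverts the nonzero elements of `C`. If a power of `P` annihilates the
annihilator of `y` in `D`, then its dimension over the fraction field of `C` is the length of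
`(J : y) / J` after localization at `P`. -/
theorem colonLength_localization_eq_finrank {C L A D : Type*} [CommRing C] [IsDomain C] [Field L]
    [Algebra C L] [IsFractionRing C L] [CommRing A] [Algebra C A] [CommRing D] [Algebra C D]
    [Algebra L D] [IsScalarTower C L D] (P : Ideal A) [P.IsPrime]
    (hsum : ∀ a, ∃ c, a - algebraMap C A c ∈ P) (hCP : ∀ c, algebraMap C A c ∈ P → c = 0)
    (J : Ideal A) (y : A) (g : A →ₐ[C] D) (hgJ : ∀ a ∈ J, g a = 0)
    (hgker : ∀ a, g a = 0 → ∃ c : C, c ≠ 0 ∧ algebraMap C A c * a ∈ J)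
    (hgsurj : ∀ d, ∃ c : C, c ≠ 0 ∧ ∃ a, c • d = g a)
    (hfin : FiniteDimensional L (LinearMap.ker (LinearMap.mulLeft L (g y)))) (k : ℕ)
    (hk : ∀ q ∈ P ^ k, ∀ d, g y * d = 0 → g q * d = 0) :
    colonLength (J.map (algebraMap A (Localization.AtPrime P)))
      (algebraMap A (Localization.AtPrime P) y) =
      Module.finrank L (LinearMap.ker (LinearMap.mulLeft L (g y))) := by
  classical
  set R' := Localization.AtPrime P
  set J' := J.map (algebraMap A R') with hJ'
  have hCprime : ∀ c : C, c ≠ 0 → algebraMap C A c ∈ P.primeCompl := fun c hc h => hc (hCP c h)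
  have hunitA : ∀ s ∈ P.primeCompl, IsUnit (algebraMap A R' s) := fun s hs =>
    IsLocalization.map_units R' (⟨s, hs⟩ : P.primeCompl)
  have hunitC : ∀ c : nonZeroDivisors C, IsUnit (algebraMap C R' c) := fun c =>
    by
    rw [IsScalarTower.algebraMap_apply C A R']
    exact hunitA _ (hCprime c (nonZeroDivisors.ne_zero c.2))
  -- Nonzero elements of `C` avoid `P`, so they are units in `R'` and `L` maps to `R'`.
  let : Algebra L R' := (IsLocalization.lift (M := nonZeroDivisors C) hunitC).toAlgebra
  have : IsScalarTower C L R' := IsScalarTower.of_algebraMap_eq fun c =>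
    (IsLocalization.lift_eq hunitC c).symm
  have hneL : ∀ c : C, c ≠ 0 → algebraMap C L c ≠ 0 := fun c hc =>
    IsFractionRing.to_map_ne_zero_of_mem_nonZeroDivisors (mem_nonZeroDivisors_of_ne_zero hc)
  have : IsScalarTower C L (R' ⧸ J') := by
    refine ⟨fun c l x => ?_⟩
    obtain ⟨x, rfl⟩ := Ideal.Quotient.mk_surjective x
    change Ideal.Quotient.mk J' ((c • l) • x) = Ideal.Quotient.mk J' (c • l • x)
    rw [smul_assoc]
  -- the comparison map
  set f : A ⧸ J →ₗ[C] D := (Ideal.Quotient.liftₐ J g hgJ).toLinearMap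
  have hf : ∀ a, f (Ideal.Quotient.mk J a) = g a := fun a => rfl
  have : IsLocalizedModule (nonZeroDivisors C) f := by
    refine ⟨?_, ?_, ?_⟩
    · intro c
      rw [Module.End.isUnit_iff]
      have hc := hneL c (nonZeroDivisors.ne_zero c.2)
      constructor
      · intro x x' h
        change (c : C) • x = (c : C) • x' at h
        rw [← algebraMap_smul L (c : C) x, ← algebraMap_smul L (c : C) x'] at h
        exact smul_right_injective D hc h
      · intro x
        refine ⟨(algebraMap C L c)⁻¹ • x, ?_⟩
        change (c : C) • (algebraMap C L c)⁻¹ • x = x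
        rw [← algebraMap_smul L (c : C), smul_smul, mul_inv_cancel₀ hc, one_smul]
    · intro d
      obtain ⟨c, hc, a, ha⟩ := hgsurj d
      exact ⟨(Ideal.Quotient.mk J a, ⟨c, mem_nonZeroDivisors_of_ne_zero hc⟩), ha⟩
    · intro x x' h
      obtain ⟨a, rfl⟩ := Ideal.Quotient.mk_surjective x
      obtain ⟨a', rfl⟩ := Ideal.Quotient.mk_surjective x'
      rw [hf, hf, ← sub_eq_zero, ← map_sub] at h
      obtain ⟨c, hc, hcJ⟩ := hgker _ h
      refine ⟨⟨c, mem_nonZeroDivisors_of_ne_zero hc⟩, ?_⟩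
      change c • Ideal.Quotient.mk J a = c • Ideal.Quotient.mk J a'
      rw [Algebra.smul_def, Algebra.smul_def, ← sub_eq_zero, ← mul_sub, ← map_sub]
      change Ideal.Quotient.mk J (algebraMap C A c) * Ideal.Quotient.mk J (a - a') = 0
      rw [← map_mul]
      exact Ideal.Quotient.eq_zero_iff_mem.mpr hcJ
  set f' : A ⧸ J →ₗ[C] R' ⧸ J' := (Ideal.quotientMapₐ J' (IsScalarTower.toAlgHom C A R')
    (by rw [hJ']; exact Ideal.le_comap_map)).toLinearMap
  have hf' : ∀ a, f' (Ideal.Quotient.mk J a) = Ideal.Quotient.mk J' (algebraMap A R' a) :=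
    fun a => rfl
  have hunitEnd : ∀ c : nonZeroDivisors C, IsUnit (algebraMap C (Module.End C (R' ⧸ J')) c) := by
    intro c
    rw [Module.End.isUnit_iff]
    have hc := hneL c (nonZeroDivisors.ne_zero c.2)
    constructor
    · intro x x' h
      change (c : C) • x = (c : C) • x' at h
      rw [← algebraMap_smul L (c : C) x, ← algebraMap_smul L (c : C) x'] at h
      have := congrArg (fun x => (algebraMap C L c)⁻¹ • x) h
      simpa only [smul_smul, inv_mul_cancel₀ hc, one_smul] using this
    · intro x
      refine ⟨(algebraMap C L c)⁻¹ • x, ?_⟩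
      change (c : C) • (algebraMap C L c)⁻¹ • x = x
      rw [← algebraMap_smul L (c : C), smul_smul, mul_inv_cancel₀ hc, one_smul]
  have hmk : ∀ r x : R', Ideal.Quotient.mk J' (r * x) = r • Ideal.Quotient.mk J' x :=
    fun _ _ => rfl
  set Θ₀ : D →ₗ[C] R' ⧸ J' := IsLocalizedModule.lift (nonZeroDivisors C) f f' hunitEnd
  have hΘ₀ : ∀ a, Θ₀ (g a) = Ideal.Quotient.mk J' (algebraMap A R' a) := fun a =>
    (IsLocalizedModule.lift_apply (nonZeroDivisors C) f f' hunitEnd (Ideal.Quotient.mk J a))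
  set Θ : D →ₗ[L] R' ⧸ J' :=
    LinearMap.extendScalarsOfIsLocalization (nonZeroDivisors C) L Θ₀
  have hΘg : ∀ a, Θ (g a) = Ideal.Quotient.mk J' (algebraMap A R' a) := hΘ₀
  have hΘmul : ∀ a d, Θ (g a * d) = algebraMap A R' a • Θ d := by
    intro a d
    obtain ⟨c, hc, b, hb⟩ := hgsurj d
    have hcL := hneL c hc
    have h1 : algebraMap C L c • Θ (g a * d) = algebraMap C L c • algebraMap A R' a • Θ d := by
      rw [← map_smul, ← mul_smul_comm, algebraMap_smul L c d, hb, ← map_mul, hΘg, smul_comm,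
        ← map_smul, algebraMap_smul L c d, hb, hΘg, map_mul, hmk]
    have := congrArg (fun x => (algebraMap C L c)⁻¹ • x) h1
    simpa only [smul_smul, inv_mul_cancel₀ hcL, one_smul] using this
  set N := LinearMap.ker (LinearMap.mulLeft L (g y)) with hNdef
  have hN : ∀ d, d ∈ N ↔ g y * d = 0 := fun d => by
    rw [hNdef, LinearMap.mem_ker, LinearMap.mulLeft_apply]
  -- elements outside of `P` act injectively, hence bijectively, on `N`
  have hinj : ∀ s ∈ P.primeCompl, ∀ d ∈ N, g s * d = 0 → d = 0 := by
    intro s hs d hd h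
    obtain ⟨c, hc⟩ := hsum s
    have hc0 : c ≠ 0 := by
      rintro rfl
      rw [map_zero, sub_zero] at hc
      exact hs hc
    -- If `s` kills `d`, then `s - c` acts on `d` as the nonzero scalar `-c`; but `s - c ∈ P`, and
    -- its `k`-th power kills `d`.
    have h1 : g (s - algebraMap C A c) * d = (-(algebraMap C L c)) • d := by
      rw [map_sub, sub_mul, h, zero_sub, neg_smul, AlgHom.commutes, Algebra.smul_def,
        ← IsScalarTower.algebraMap_apply]
    have h2 : ∀ j, g (s - algebraMap C A c) ^ j * d = (-(algebraMap C L c)) ^ j • d := by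
      intro j
      induction j with
      | zero => simp
      | succ j ih => rw [pow_succ, mul_assoc, h1, mul_smul_comm, ih, smul_smul, pow_succ']
    have h3 := hk _ (Ideal.pow_mem_pow hc k) d ((hN d).mp hd)
    rw [map_pow, h2] at h3
    exact (smul_eq_zero.mp h3).resolve_left (pow_ne_zero _ (neg_ne_zero.mpr (hneL c hc0)))
  have hbij : ∀ s ∈ P.primeCompl, ∀ d ∈ N, ∃ e ∈ N, g s * e = d := by
    intro s hs d hd
    set μ : N →ₗ[L] N := (LinearMap.mulLeft L (g s)).restrict (fun e he => by
      rw [hN] at he ⊢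
      rw [LinearMap.mulLeft_apply, mul_left_comm, he, mul_zero])
    have hμ : Function.Injective μ := by
      rw [← LinearMap.ker_eq_bot, LinearMap.ker_eq_bot']
      intro e he
      rw [Subtype.ext_iff] at he ⊢
      exact hinj s hs e e.2 he
    obtain ⟨e, he⟩ := LinearMap.injective_iff_surjective.mp hμ ⟨d, hd⟩
    exact ⟨e, e.2, congrArg Subtype.val he⟩
  set T := Submodule.torsionBy R' (R' ⧸ J') (algebraMap A R' y) with hT
  set Ψ : N →ₗ[L] T := (Θ.comp N.subtype).codRestrict (T.restrictScalars L) (by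
    rintro ⟨d, hd⟩
    rw [Submodule.restrictScalars_mem, hT, Submodule.mem_torsionBy_iff]
    change algebraMap A R' y • Θ d = 0
    rw [← hΘmul, (hN d).mp hd, map_zero]) with hΨ
  have hΨinj : Function.Injective Ψ := by
    rw [← LinearMap.ker_eq_bot, LinearMap.ker_eq_bot']
    rintro ⟨d, hd⟩ h
    rw [Subtype.ext_iff] at h
    change Θ d = 0 at h
    rw [Subtype.ext_iff]
    change d = 0
    obtain ⟨c, hc, b, hb⟩ := hgsurj d
    have h1 : Ideal.Quotient.mk J' (algebraMap A R' b) = 0 := by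
      rw [← hΘg, ← hb, ← algebraMap_smul L c d, map_smul, h, smul_zero]
    rw [Ideal.Quotient.eq_zero_iff_mem, hJ',
      IsLocalization.algebraMap_mem_map_algebraMap_iff P.primeCompl] at h1
    obtain ⟨s, hs, hsJ⟩ := h1
    have h2 := hgJ _ hsJ
    rw [map_mul, ← hb, mul_smul_comm, ← algebraMap_smul L c] at h2
    exact hinj s hs d hd ((smul_eq_zero.mp h2).resolve_left (hneL c hc))
  -- If `y` kills the class of `a / s`, then `t y a ∈ J` for some `t` outside `P`. Hence `g (t a)`
  -- lies in `N`, where division by `t s` is possible.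
  have hΨsurj : Function.Surjective Ψ := by
    rintro ⟨x, hx⟩
    obtain ⟨x, rfl⟩ := Ideal.Quotient.mk_surjective x
    obtain ⟨⟨a, s⟩, rfl⟩ := IsLocalization.mk'_surjective P.primeCompl x
    rw [Submodule.mem_torsionBy_iff] at hx
    have hsx : algebraMap A R' s • Ideal.Quotient.mk J' (IsLocalization.mk' R' a s) =
        Ideal.Quotient.mk J' (algebraMap A R' a) := by
      change Ideal.Quotient.mk J' (algebraMap A R' s * IsLocalization.mk' R' a s) = _
      rw [IsLocalization.mk'_spec']
    have h1 : Ideal.Quotient.mk J' (algebraMap A R' (y * a)) = 0 := by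
      rw [map_mul, hmk, ← hsx, smul_comm, hx, smul_zero]
    rw [Ideal.Quotient.eq_zero_iff_mem, hJ',
      IsLocalization.algebraMap_mem_map_algebraMap_iff P.primeCompl] at h1
    obtain ⟨t, ht, htJ⟩ := h1
    have h2 : g (t * a) ∈ N := by
      rw [hN, ← map_mul, ← mul_assoc, mul_comm y t, mul_assoc]
      exact hgJ _ htJ
    obtain ⟨e, he, hse⟩ := hbij (t * s) (P.primeCompl.mul_mem ht s.2) _ h2
    refine ⟨⟨e, he⟩, ?_⟩
    rw [Subtype.ext_iff]
    change Θ e = Ideal.Quotient.mk J' (IsLocalization.mk' R' a s)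
    have h3 := congrArg Θ hse
    rw [hΘmul, hΘg, map_mul (algebraMap A R') t a, hmk, ← hsx,
      map_mul (algebraMap A R') t s, mul_smul] at h3
    exact (hunitA s s.2).smul_left_cancel.mp ((hunitA t ht).smul_left_cancel.mp h3)
  have hlen : Module.length R' T = Module.length L T := by
    refine length_eq_of_coefficientField (P.map (algebraMap A R')) ?_ k T ?_
    · intro x
      obtain ⟨⟨a, s⟩, rfl⟩ := IsLocalization.mk'_surjective P.primeCompl x
      obtain ⟨c, hc⟩ := hsum a
      obtain ⟨c', hc'⟩ := hsum s
      have hc0 : c' ≠ 0 := by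
        rintro rfl
        rw [map_zero, sub_zero] at hc'
        exact s.2 hc'
      have hcL := hneL c' hc0
      -- With `a ≡ c` and `s ≡ c'` modulo `P`, the residue of `a / s` is `c / c'`.
      refine ⟨algebraMap C L c * (algebraMap C L c')⁻¹, ?_⟩
      rw [← (Ideal.unit_mul_mem_iff_mem _ (hunitA s s.2)),
        ← (Ideal.unit_mul_mem_iff_mem _ (hunitA _ (hCprime c' hc0)))]
      have h1 : algebraMap A R' (algebraMap C A c') * (algebraMap A R' s *
          (IsLocalization.mk' R' a s -
            algebraMap L R' (algebraMap C L c * (algebraMap C L c')⁻¹))) =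
          algebraMap A R' (algebraMap C A c' * (a - algebraMap C A c) -
            algebraMap C A c * (s - algebraMap C A c')) := by
        have h2 : algebraMap A R' (algebraMap C A c') *
            algebraMap L R' (algebraMap C L c * (algebraMap C L c')⁻¹) =
            algebraMap A R' (algebraMap C A c) := by
          rw [← IsScalarTower.algebraMap_apply C A R', ← IsScalarTower.algebraMap_apply C A R',
            IsScalarTower.algebraMap_apply C L R', IsScalarTower.algebraMap_apply C L R' c,
            ← map_mul]
          congr 1
          field_simp
        rw [mul_sub, IsLocalization.mk'_spec', mul_sub, mul_left_comm, h2]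
        simp only [map_sub, map_mul]
        ring
      rw [h1]
      exact Ideal.mem_map_of_mem _ (P.sub_mem (P.mul_mem_left _ hc) (P.mul_mem_left _ hc'))
    · intro q hq x
      obtain ⟨⟨d, hd⟩, rfl⟩ := hΨsurj x
      rw [← Ideal.map_pow] at hq
      have hle : P ^ k ≤ (Ideal.comap (algebraMap A R')
          (Module.annihilator R' (Submodule.span R' {Θ d}))) := by
        intro q hq
        rw [Ideal.mem_comap, Submodule.mem_annihilator_span_singleton, ← hΘmul,
          hk q hq d ((hN d).mp hd), map_zero]
      have := Ideal.map_le_iff_le_comap.mpr hle hq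
      rw [Submodule.mem_annihilator_span_singleton] at this
      rw [Subtype.ext_iff]
      exact this
  rw [colonLength_eq_length_torsionBy, ← hT, hlen,
    ← (LinearEquiv.ofBijective Ψ ⟨hΨinj, hΨsurj⟩).length_eq, Module.length_eq_finrank]

theorem C_mem_idealOfVars_iff {K σ : Type*} [Field K] (c : K) :
    (C c : MvPolynomial σ K) ∈ idealOfVars σ K ↔ c = 0 := by
  constructor
  · intro h
    rw [← pow_one (idealOfVars σ K), mem_pow_idealOfVars_iff'] at h
    have := h 0 (by simp)
    simpa using this
  · rintro rfl
    simp

theorem sub_C_constantCoeff_mem_idealOfVars {K σ : Type*} [Field K] (f : MvPolynomial σ K) :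
    f - C (constantCoeff f) ∈ idealOfVars σ K := by
  rw [← pow_one (idealOfVars σ K), mem_pow_idealOfVars_iff']
  intro c hc
  have : c = 0 := (Finsupp.degree_eq_zero_iff c).mp (Nat.lt_one_iff.mp hc)
  subst this
  simp [constantCoeff_eq]

theorem map_mem_idealOfVars_pow {K L σ : Type*} [Field K] [Field L] (p : K →+* L)
    {f : MvPolynomial σ K} {k : ℕ} (hf : f ∈ idealOfVars σ K ^ k) :
    map p f ∈ idealOfVars σ L ^ k := by
  rw [mem_pow_idealOfVars_iff'] at hf ⊢
  intro c hc
  rw [coeff_map, hf c hc, map_zero]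

section

attribute [local instance] MvPolynomial.algebraMvPolynomial

theorem exists_sub_algebraMap_mem_map_C {K A τ : Type*} [CommRing K] [CommRing A] [Algebra K A]
    (m : Ideal A) (h : ∀ x : A, ∃ c : K, x - algebraMap K A c ∈ m) (a : MvPolynomial τ A) :
    ∃ c : MvPolynomial τ K, a - algebraMap (MvPolynomial τ K) (MvPolynomial τ A) c ∈
      m.map (C : A →+* MvPolynomial τ A) := by
  induction a using MvPolynomial.induction_on' with
  | monomial u x =>
    obtain ⟨c, hc⟩ := h x
    refine ⟨monomial u c, ?_⟩
    rw [algebraMap_def, map_monomial, ← map_sub, ← mul_one (x - _), ← C_mul_monomial]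
    exact Ideal.mul_mem_right _ _ (Ideal.mem_map_of_mem _ hc)
  | add a b ha hb =>
    obtain ⟨c, hc⟩ := ha
    obtain ⟨d, hd⟩ := hb
    refine ⟨c + d, ?_⟩
    rw [map_add, add_sub_add_comm]
    exact Ideal.add_mem _ hc hd

/-- The `t`-value of the image of `I` modulo `T` is the dimension of the kernel of the
multiplication by the generic linear combination of the `z j` after extension of the coefficients
to the field of rational functions. -/
theorem tValue_quotient_eq_finrank {K σ τ : Type*} [Field K] [Fintype τ]
    (T I : Ideal (MvPolynomial σ K))
    [((idealOfVars σ K).map (Ideal.Quotient.mk T)).IsPrime] (hT : T ≤ idealOfVars σ K)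
    (z : τ → MvPolynomial σ K) (L : Type*) [Field L] [Algebra K L] [Algebra (MvPolynomial τ K) L]
    [IsScalarTower K (MvPolynomial τ K) L] [IsFractionRing (MvPolynomial τ K) L]
    (J : Ideal (MvPolynomial σ L)) (hJ : J = (I ⊔ T).map (map (algebraMap K L)))
    (w : MvPolynomial σ L)
    (hw : w = ∑ j, C (algebraMap (MvPolynomial τ K) L (X j)) * map (algebraMap K L) (z j))
    (hfin : FiniteDimensional L (mulKer J w)) (k : ℕ)
    (hk : ∀ g ∈ idealOfVars σ L ^ k, ∀ f, w * f ∈ J → g * f ∈ J) :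
    tValue (fun j => Ideal.Quotient.mk T (z j)) ((idealOfVars σ K).map (Ideal.Quotient.mk T))
      (I.map (Ideal.Quotient.mk T)) = Module.finrank L (mulKer J w) := by
  classical
  set m₀ : Ideal (MvPolynomial σ K ⧸ T) := (idealOfVars σ K).map (Ideal.Quotient.mk T)
  set φ : (MvPolynomial σ K ⧸ T) →+* MvPolynomial σ L ⧸ J :=
    Ideal.Quotient.lift T ((Ideal.Quotient.mk J).comp (map (algebraMap K L))) (by
      intro t ht
      rw [RingHom.comp_apply, Ideal.Quotient.eq_zero_iff_mem, hJ]
      exact Ideal.mem_map_of_mem _ (Ideal.mem_sup_right ht)) with hφ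
  have hφmk : ∀ f, φ (Ideal.Quotient.mk T f) = Ideal.Quotient.mk J (map (algebraMap K L) f) :=
    fun f => rfl
  -- The map `(K[x]/T)[X] → K(X)[x]/J` that turns the indeterminates `X` into scalars.
  set g₀ : MvPolynomial τ (MvPolynomial σ K ⧸ T) →+* MvPolynomial σ L ⧸ J := eval₂Hom φ
    (fun j => Ideal.Quotient.mk J (C (algebraMap (MvPolynomial τ K) L (X j)))) with hg₀
  have hKL : ∀ c : K, algebraMap (MvPolynomial τ K) L (C c) = algebraMap K L c := fun c =>
    (IsScalarTower.algebraMap_apply K (MvPolynomial τ K) L c).symm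
  have hcomm : ∀ c : MvPolynomial τ K, g₀ (algebraMap
        (MvPolynomial τ K) (MvPolynomial τ (MvPolynomial σ K ⧸ T)) c) =
      algebraMap (MvPolynomial τ K) (MvPolynomial σ L ⧸ J) c := by
    intro c
    have : g₀.comp (algebraMap (MvPolynomial τ K) (MvPolynomial τ (MvPolynomial σ K ⧸ T))) =
        (Ideal.Quotient.mk J).comp ((C : L →+* MvPolynomial σ L).comp
          (algebraMap (MvPolynomial τ K) L)) := by
      apply MvPolynomial.ringHom_ext
      · intro c
        rw [RingHom.comp_apply, algebraMap_def, MvPolynomial.map_C, hg₀, coe_eval₂Hom, eval₂_C]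
        change φ (Ideal.Quotient.mk T (C c)) = _
        rw [hφmk, MvPolynomial.map_C, RingHom.comp_apply, RingHom.comp_apply, hKL]
      · intro j
        rw [RingHom.comp_apply, algebraMap_def, MvPolynomial.map_X, hg₀, coe_eval₂Hom, eval₂_X]
        rfl
    exact DFunLike.congr_fun this c
  set g : MvPolynomial τ (MvPolynomial σ K ⧸ T) →ₐ[MvPolynomial τ K] MvPolynomial σ L ⧸ J :=
    { g₀ with commutes' := hcomm } with hg
  have hgC : ∀ f, g (C (Ideal.Quotient.mk T f)) = Ideal.Quotient.mk J (map (algebraMap K L) f) := by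
    intro f
    change g₀ _ = _
    rw [hg₀, coe_eval₂Hom, eval₂_C, hφmk]
  -- exchange of the two sets of variables
  set e := commAlgEquiv K τ σ
  have hge : ∀ b : MvPolynomial τ (MvPolynomial σ K), g (map (Ideal.Quotient.mk T) b) =
      Ideal.Quotient.mk J (map (algebraMap (MvPolynomial τ K) L) (e b)) := by
    intro b
    have : (g : MvPolynomial τ (MvPolynomial σ K ⧸ T) →+* _).comp (map (Ideal.Quotient.mk T)) =
        (Ideal.Quotient.mk J).comp ((map (algebraMap (MvPolynomial τ K) L)).comp
          (e : MvPolynomial τ (MvPolynomial σ K) →+* MvPolynomial σ (MvPolynomial τ K))) := by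
      apply MvPolynomial.ringHom_ext
      · intro f
        simp only [RingHom.comp_apply, MvPolynomial.map_C]
        change g (C _) = Ideal.Quotient.mk J (map _ (e (C f)))
        rw [hgC, commAlgEquiv_C, map_map]
        congr 3
        ext c
        exact (hKL c).symm
      · intro j
        simp only [RingHom.comp_apply, MvPolynomial.map_X]
        change g₀ (X j) = Ideal.Quotient.mk J (map _ (e (X j)))
        rw [commAlgEquiv_X, MvPolynomial.map_C, hg₀, coe_eval₂Hom, eval₂_X]
    exact DFunLike.congr_fun this b
  have hJC : J = ((I ⊔ T).map (map (C : K →+* MvPolynomial τ K))).map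
      (algebraMap (MvPolynomial σ (MvPolynomial τ K)) (MvPolynomial σ L)) := by
    rw [hJ, Ideal.map_map, algebraMap_def]
    congr 1
    ext c
    · simp [hKL]
    · simp
  have hgy : g (∑ j, X j * C (Ideal.Quotient.mk T (z j))) = Ideal.Quotient.mk J w := by
    rw [hw, map_sum, map_sum]
    refine Finset.sum_congr rfl fun j _ => ?_
    rw [map_mul, map_mul, hgC]
    congr 1
    change g₀ (X j) = _
    rw [hg₀, coe_eval₂Hom, eval₂_X]
  have hm₀ : ∀ f, Ideal.Quotient.mk T f ∈ m₀ → f ∈ idealOfVars σ K := by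
    intro f hf
    obtain ⟨f', hf', hff'⟩ := (Ideal.mem_map_iff_of_surjective _ Ideal.Quotient.mk_surjective).mp hf
    rw [Ideal.Quotient.eq] at hff'
    have := Ideal.sub_mem _ hf' (hT hff')
    rwa [sub_sub_cancel] at this
  have hsum : ∀ a : MvPolynomial τ (MvPolynomial σ K ⧸ T), ∃ c : MvPolynomial τ K,
      a - algebraMap (MvPolynomial τ K) (MvPolynomial τ (MvPolynomial σ K ⧸ T)) c ∈ m₀.map C := by
    refine exists_sub_algebraMap_mem_map_C m₀ fun x => ?_
    obtain ⟨f, rfl⟩ := Ideal.Quotient.mk_surjective x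
    exact ⟨constantCoeff f, Ideal.mem_map_of_mem (Ideal.Quotient.mk T)
      (sub_C_constantCoeff_mem_idealOfVars f)⟩
  have key := colonLength_localization_eq_finrank (C := MvPolynomial τ K) (L := L)
    (m₀.map (C : (MvPolynomial σ K ⧸ T) →+* MvPolynomial τ (MvPolynomial σ K ⧸ T))) ?_ ?_
    ((I.map (Ideal.Quotient.mk T)).map
        (C : (MvPolynomial σ K ⧸ T) →+* MvPolynomial τ (MvPolynomial σ K ⧸ T)))
    (∑ j, X j * C (Ideal.Quotient.mk T (z j))) g ?_ ?_ ?_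
    (by rw [hgy]; exact hfin) k ?_
  · rw [hgy] at key
    exact key
  · exact hsum
  · intro c hc
    rw [mem_map_C_iff] at hc
    ext u
    have := hc u
    rw [algebraMap_def, coeff_map] at this
    change Ideal.Quotient.mk T (C (coeff u c)) ∈ m₀ at this
    rw [coeff_zero]
    exact (C_mem_idealOfVars_iff _).mp (hm₀ _ this)
  · intro a ha
    have hle : (I.map (Ideal.Quotient.mk T)).map
          (C : (MvPolynomial σ K ⧸ T) →+* MvPolynomial τ (MvPolynomial σ K ⧸ T)) ≤
        RingHom.ker g := by
      rw [Ideal.map_map, Ideal.map_le_iff_le_comap]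
      intro f hf
      rw [Ideal.mem_comap, RingHom.mem_ker, RingHom.comp_apply, hgC,
        Ideal.Quotient.eq_zero_iff_mem, hJ]
      exact Ideal.mem_map_of_mem _ (Ideal.mem_sup_left hf)
    exact hle ha
  -- Lift `a` to `K[X][x]`. Membership in `J` over `K(X)` becomes membership in the extension of `I
  -- + T` after multiplication by a nonzero `c ∈ K[X]`; reducing modulo `T` leaves the extension of
  -- `I`.
  · intro a ha
    obtain ⟨b, rfl⟩ := map_surjective (Ideal.Quotient.mk T) Ideal.Quotient.mk_surjective a
    rw [hge, Ideal.Quotient.eq_zero_iff_mem, hJC, ← algebraMap_def,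
      IsLocalization.algebraMap_mem_map_algebraMap_iff
        ((nonZeroDivisors (MvPolynomial τ K)).map (C (σ := σ)))] at ha
    obtain ⟨_, ⟨c, hc, rfl⟩, hcb⟩ := ha
    refine ⟨c, nonZeroDivisors.ne_zero hc, ?_⟩
    have h1 := Ideal.mem_map_of_mem (e.symm : MvPolynomial σ (MvPolynomial τ K) →+*
      MvPolynomial τ (MvPolynomial σ K)) hcb
    have h2 : (e.symm : MvPolynomial σ (MvPolynomial τ K) →+*
      MvPolynomial τ (MvPolynomial σ K)).comp (map (C : K →+* MvPolynomial τ K)) = C := by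
      refine RingHom.ext fun f => ?_
      change e.symm (map C f) = C f
      rw [← commAlgEquiv_C, AlgEquiv.symm_apply_apply]
    have h3 : e.symm (C c) = map C c := by
      rw [AlgEquiv.symm_apply_eq]
      have : (C : MvPolynomial τ K →+* MvPolynomial σ (MvPolynomial τ K)) =
          (e : MvPolynomial τ (MvPolynomial σ K) →+* MvPolynomial σ (MvPolynomial τ K)).comp
            (map C) := by
        apply MvPolynomial.ringHom_ext
        · intro c
          rw [RingHom.comp_apply, MvPolynomial.map_C]
          change _ = e (C (C c))
          rw [commAlgEquiv_C, MvPolynomial.map_C]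
        · intro j
          rw [RingHom.comp_apply, MvPolynomial.map_X]
          change _ = e (X j)
          rw [commAlgEquiv_X]
      exact DFunLike.congr_fun this c
    rw [Ideal.map_map, h2, RingHom.coe_coe, map_mul, AlgEquiv.symm_apply_apply] at h1
    change e.symm (C c) * b ∈ _ at h1
    rw [h3] at h1
    have h4 := Ideal.mem_map_of_mem (map (Ideal.Quotient.mk T)) h1
    rw [Ideal.map_map, map_mul, map_map] at h4
    have h5 : (I ⊔ T).map ((map (Ideal.Quotient.mk T)).comp
        (C : MvPolynomial σ K →+* MvPolynomial τ (MvPolynomial σ K))) ≤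
        (I.map (Ideal.Quotient.mk T)).map
              (C : (MvPolynomial σ K ⧸ T) →+* MvPolynomial τ (MvPolynomial σ K ⧸ T)) := by
      rw [Ideal.map_le_iff_le_comap, sup_le_iff]
      constructor
      · intro f hf
        rw [Ideal.mem_comap, RingHom.comp_apply, MvPolynomial.map_C]
        exact Ideal.mem_map_of_mem _ (Ideal.mem_map_of_mem _ hf)
      · intro f hf
        rw [Ideal.mem_comap, RingHom.comp_apply, MvPolynomial.map_C,
          Ideal.Quotient.eq_zero_iff_mem.mpr hf, map_zero]
        exact Ideal.zero_mem _
    exact h5 h4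
  · intro d
    obtain ⟨f, rfl⟩ := Ideal.Quotient.mk_surjective d
    obtain ⟨⟨b, ⟨_, c, hc, rfl⟩⟩, hb⟩ := IsLocalization.surj
      ((nonZeroDivisors (MvPolynomial τ K)).map (C (σ := σ))) f
    refine ⟨c, nonZeroDivisors.ne_zero hc, map (Ideal.Quotient.mk T) (e.symm b), ?_⟩
    rw [hge, AlgEquiv.apply_symm_apply, ← algebraMap_def, ← hb, algebraMap_def]
    change c • Ideal.Quotient.mk J f = Ideal.Quotient.mk J (f * map _ (C c))
    rw [MvPolynomial.map_C, mul_comm, ← smul_eq_C_mul, ← algebraMap_smul L c]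
    rfl
  · intro q hq d hd
    obtain ⟨f, rfl⟩ := Ideal.Quotient.mk_surjective d
    rw [hgy, ← map_mul, Ideal.Quotient.eq_zero_iff_mem] at hd
    rw [← Ideal.map_pow, ← Ideal.map_pow, Ideal.map_map] at hq
    have hle : (idealOfVars σ K ^ k).map
          ((C : (MvPolynomial σ K ⧸ T) →+* MvPolynomial τ (MvPolynomial σ K ⧸ T)).comp
        (Ideal.Quotient.mk T)) ≤
        (Module.annihilator _ (Ideal.span {Ideal.Quotient.mk J f})).comap g := by
      rw [Ideal.map_le_iff_le_comap]
      intro r hr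
      rw [Ideal.mem_comap, Ideal.mem_comap, RingHom.comp_apply, hgC]
      refine (Submodule.mem_annihilator_span_singleton _ _).mpr ?_
      rw [smul_eq_mul, ← map_mul, Ideal.Quotient.eq_zero_iff_mem]
      exact hk _ (map_mem_idealOfVars_pow _ hr) f hd
    have := (Submodule.mem_annihilator_span_singleton _ _).mp (hle hq)
    exact this

end

/-! ### Filter regularity of general linear forms. -/

theorem eq_idealOfVars_of_forall_X_mem {K σ : Type*} [Field K] (P : Ideal (MvPolynomial σ K))
    (hP : P ≠ ⊤) (h : ∀ k, (X k : MvPolynomial σ K) ∈ P) : P = idealOfVars σ K := by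
  have hle : idealOfVars σ K ≤ P := by
    rw [idealOfVars, Ideal.span_le]
    rintro _ ⟨k, rfl⟩
    exact h k
  refine le_antisymm (fun f hf => ?_) hle
  have h1 := sub_C_constantCoeff_mem_idealOfVars f
  have h2 : C (constantCoeff f) ∈ P := by
    have := P.sub_mem hf (hle h1)
    rwa [sub_sub_cancel] at this
  by_cases h0 : constantCoeff f = 0
  · rwa [h0, map_zero, sub_zero] at h1
  · exact absurd (P.eq_top_of_isUnit_mem h2 ((Ne.isUnit h0).map C)) hP

theorem sub_sum_homogeneousComponent_mem {K σ : Type*} [Field K] (f : MvPolynomial σ K) (k : ℕ) :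
    f - ∑ i ∈ Finset.range k, homogeneousComponent i f ∈ idealOfVars σ K ^ k := by
  rw [mem_pow_idealOfVars_iff']
  intro c hc
  rw [coeff_sub, coeff_sum]
  simp only [coeff_homogeneousComponent]
  rw [Finset.sum_ite_eq, if_pos (Finset.mem_range.mpr hc), sub_self]

/-- The kernel is a finitely generated module annihilated by the `k`-th power of the maximal ideal,
so the coefficients of its generators may be truncated below degree `k`. -/
theorem finiteDimensional_mulKer_of_pow_smul {K σ : Type*} [Field K] [Finite σ]
    (J : Ideal (MvPolynomial σ K)) (z : MvPolynomial σ K) (k : ℕ)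
    (h : ∀ g ∈ idealOfVars σ K ^ k, ∀ x ∈ mulKer J z, g • x = 0) :
    FiniteDimensional K (mulKer J z) := by
  obtain ⟨s, hs⟩ : (Submodule.torsionBy (MvPolynomial σ K) (MvPolynomial σ K ⧸ J) z).FG :=
    IsNoetherian.noetherian _
  have hmem : ∀ x, x ∈ mulKer J z ↔
      x ∈ Submodule.torsionBy (MvPolynomial σ K) (MvPolynomial σ K ⧸ J) z := by
    intro x
    rw [Submodule.mem_torsionBy_iff]
    exact Iff.rfl
  set Φ : (s → restrictTotalDegree σ K k) →ₗ[K] MvPolynomial σ K ⧸ J :=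
    ∑ x : s, ((LinearMap.toSpanSingleton (MvPolynomial σ K) _
        (x : MvPolynomial σ K ⧸ J)).restrictScalars
      K).comp ((restrictTotalDegree σ K k).subtype.comp (LinearMap.proj x)) with hΦ
  have hle : mulKer J z ≤ LinearMap.range Φ := by
    intro y hy
    rw [hmem, ← hs, ← Subtype.range_coe (s := (s : Set (MvPolynomial σ K ⧸ J))),
      Submodule.mem_span_range_iff_exists_fun] at hy
    obtain ⟨c, rfl⟩ := hy
    refine ⟨fun x => ⟨∑ i ∈ Finset.range k, homogeneousComponent i (c x), ?_⟩, ?_⟩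
    · rw [mem_restrictTotalDegree]
      refine totalDegree_finsetSum_le fun i hi => ?_
      exact (homogeneousComponent_isHomogeneous i _).totalDegree_le.trans
        (Finset.mem_range.mp hi).le
    · rw [hΦ, LinearMap.sum_apply]
      refine Finset.sum_congr rfl fun x _ => ?_
      change (∑ i ∈ Finset.range k, homogeneousComponent i (c x)) • (x : MvPolynomial σ K ⧸ J) = _
      rw [← sub_eq_zero, ← neg_eq_zero, neg_sub, ← sub_smul]
      refine h _ (sub_sum_homogeneousComponent_mem _ k) _ ?_
      rw [hmem, ← hs]
      exact Submodule.subset_span x.2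
  exact Submodule.finiteDimensional_of_le hle

/-- The linear forms in `P` make up a proper subspace, since a proper ideal with all variables is
the graded maximal ideal. `G` is the equation of a hyperplane containing that subspace. -/
theorem exists_linear_eval_ne_zero {K : Type*} [Field K] {n : ℕ}
    (P : Ideal (MvPolynomial (Fin n) K)) (hP : P ≠ ⊤) (hPm : P ≠ idealOfVars (Fin n) K) :
    ∃ G : MvPolynomial (Fin n) K, G ≠ 0 ∧
      ∀ v : Fin n → K, eval v G ≠ 0 → ∑ k, v k • X k ∉ P := by
  set ψ : (Fin n → K) →ₗ[K] MvPolynomial (Fin n) K :=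
    Fintype.linearCombination K X with hψ
  have hψ' : ∀ v, ψ v = ∑ k, v k • X k := fun v => Fintype.linearCombination_apply K X v
  set U : Submodule K (Fin n → K) := (P.restrictScalars K).comap ψ
  have hU : U < ⊤ := by
    rw [lt_top_iff_ne_top]
    intro h
    refine hPm (eq_idealOfVars_of_forall_X_mem P hP fun k => ?_)
    have : Pi.single k 1 ∈ U := by rw [h]; trivial
    have h2 : ψ (Pi.single k 1) = X k := by
      rw [hψ, Fintype.linearCombination_apply_single, one_smul]
    change ψ (Pi.single k 1) ∈ P at this
    rwa [h2] at this
  obtain ⟨f, hf0, hf⟩ := Submodule.exists_le_ker_of_lt_top U hU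
  have heval : ∀ v, eval v (∑ k, C (f (Pi.single k 1)) * X k) = f v := by
    intro v
    simp only [map_sum, map_mul, eval_C, eval_X]
    conv_rhs => rw [pi_eq_sum_univ' v, map_sum]
    refine Finset.sum_congr rfl fun k _ => ?_
    rw [map_smul, smul_eq_mul, mul_comm]
  refine ⟨∑ k, C (f (Pi.single k 1)) * X k, ?_, ?_⟩
  · intro h
    refine hf0 (LinearMap.ext fun v => ?_)
    rw [← heval, h, map_zero]
    rfl
  · intro v hv hmem
    apply hv
    rw [heval]
    refine hf ?_
    change ψ v ∈ P
    rwa [hψ']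

/-- A general linear form is filter regular on the residue class ring of `J`. -/
theorem exists_finiteDimensional_mulKer {K : Type*} [Field K] [Infinite K] {n : ℕ}
    (J : Ideal (MvPolynomial (Fin n) K)) (G : MvPolynomial (Fin n) K) (hG : G ≠ 0) :
    ∃ v : Fin n → K, eval v G ≠ 0 ∧ FiniteDimensional K (mulKer J (∑ k, v k • X k)) := by
  classical
  have hfin := associatedPrimes.finite (MvPolynomial (Fin n) K) ((MvPolynomial (Fin n) K) ⧸ J)
  have hH : ∀ P : Ideal (MvPolynomial (Fin n) K), ∃ H : (MvPolynomial (Fin n) K), H ≠ 0 ∧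
        (P ≠ ⊤ → P ≠ idealOfVars (Fin n) K →
      ∀ v : Fin n → K, eval v H ≠ 0 → ∑ k, v k • X k ∉ P) := by
    intro P
    by_cases h : P ≠ ⊤ ∧ P ≠ idealOfVars (Fin n) K
    · obtain ⟨H, h0, h1⟩ := exists_linear_eval_ne_zero P h.1 h.2
      exact ⟨H, h0, fun _ _ => h1⟩
    · exact ⟨1, one_ne_zero, fun h1 h2 => absurd ⟨h1, h2⟩ h⟩
  choose H hH0 hH using hH
  -- Only finitely many associated primes have to be avoided; the factor `G` retains the prescribed
  -- open condition.
  have hne : G * ∏ P ∈ hfin.toFinset, H P ≠ 0 :=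
    mul_ne_zero hG (Finset.prod_ne_zero_iff.mpr fun P _ => hH0 P)
  obtain ⟨v, hv⟩ : ∃ v : Fin n → K, eval v (G * ∏ P ∈ hfin.toFinset, H P) ≠ 0 := by
    by_contra! h
    exact hne (MvPolynomial.funext fun v => by rw [h v, map_zero])
  rw [map_mul, map_prod] at hv
  refine ⟨v, left_ne_zero_of_mul hv, ?_⟩
  have hvP := Finset.prod_ne_zero_iff.mp (right_ne_zero_of_mul hv)
  set z : (MvPolynomial (Fin n) K) := ∑ k, v k • X k
  set N := Submodule.torsionBy (MvPolynomial (Fin n) K) ((MvPolynomial (Fin n) K) ⧸ J) z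
  have hass : ∀ P ∈ associatedPrimes (MvPolynomial (Fin n) K) N, P = idealOfVars (Fin n) K := by
    intro P hP
    have h1 : P ∈ associatedPrimes (MvPolynomial (Fin n) K) ((MvPolynomial (Fin n) K) ⧸ J) :=
      associatedPrimes.subset_of_injective N.subtype_injective hP
    have h2 : z ∈ P := by
      refine IsAssociatedPrime.annihilator_le hP ?_
      rw [Submodule.mem_annihilator]
      exact fun x _ => Subtype.ext ((Submodule.mem_torsionBy_iff z _).mp x.2)
    by_contra hne
    exact hH P hP.isPrime.ne_top hne v (hvP P (hfin.mem_toFinset.mpr h1)) h2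
  -- The torsion has no associated prime besides the graded maximal ideal, so a power of that ideal
  -- annihilates it.
  have hrad : idealOfVars (Fin n) K ≤ (Module.annihilator (MvPolynomial (Fin n) K) N).radical := by
    rw [← Ideal.sInf_minimalPrimes]
    refine le_sInf fun P hP => ?_
    have := Module.associatedPrimes.minimalPrimes_annihilator_subset_associatedPrimes
        (MvPolynomial (Fin n) K) N hP
    rw [hass P this]
  obtain ⟨k, hk⟩ := Ideal.exists_pow_le_of_le_radical_of_fg hrad (IsNoetherian.noetherian _)
  refine finiteDimensional_mulKer_of_pow_smul J z k fun g hg x hx => ?_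
  have hxN : x ∈ N := by
    rw [Submodule.mem_torsionBy_iff]
    exact hx
  exact congrArg Subtype.val (Module.mem_annihilator.mp (hk hg) ⟨x, hxN⟩)

/-! ### Matrices of linear forms and the generic `t`-value. -/

/-- Replace the `i`-th row of a matrix. -/
def setRow {K : Type*} {n : ℕ} (b : Fin n × Fin n → K) (i : Fin n)
    (v : Fin n → K) : Fin n × Fin n → K :=
  fun jk => if jk.1 = i then v jk.2 else b jk

theorem setRow_self {K : Type*} {n : ℕ} (b : Fin n × Fin n → K) (i : Fin n) :
    setRow b i (fun k => b (i, k)) = b := by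
  ext ⟨j, k⟩
  simp only [setRow]
  split_ifs with h
  · rw [h]
  · rfl

section Rows

variable {K : Type*} [Field K] {n : ℕ}

/-- The specialization of a polynomial in the entries of a matrix to a polynomial in the `i`-th
row. -/
noncomputable def substRow (b : Fin n × Fin n → K) (i : Fin n)
    (F : MvPolynomial (Fin n × Fin n) K) : MvPolynomial (Fin n) K :=
  aeval (fun jk : Fin n × Fin n => if jk.1 = i then X jk.2 else C (b jk)) F

theorem eval_substRow (b : Fin n × Fin n → K) (i : Fin n) (F : MvPolynomial (Fin n × Fin n) K)
    (v : Fin n → K) : eval v (substRow b i F) = eval (setRow b i v) F := by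
  rw [substRow, ← coe_aeval_eq_eval, ← coe_aeval_eq_eval, RingHom.coe_coe, RingHom.coe_coe,
    ← AlgHom.comp_apply]
  congr 1
  ext jk
  simp only [AlgHom.comp_apply, aeval_X, setRow]
  split_ifs <;> simp

theorem substRow_ne_zero {b : Fin n × Fin n → K} (i : Fin n) {F : MvPolynomial (Fin n × Fin n) K}
    (h : eval b F ≠ 0) : substRow b i F ≠ 0 := by
  intro h0
  have := eval_substRow b i F (fun k => b (i, k))
  rw [h0, map_zero, setRow_self] at this
  exact h this.symm

theorem linForm_setRow_self (b : Fin n × Fin n → K) (i : Fin n) (v : Fin n → K) :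
    linForm (setRow b i v) i = ∑ k, v k • X k := by
  simp [linForm, setRow]

theorem linForm_congr {a b : Fin n × Fin n → K} {j : Fin n} (h : ∀ k, a (j, k) = b (j, k)) :
    linForm a j = linForm b j := by
  simp [linForm, h]

theorem tailIdeal_congr {a b : Fin n × Fin n → K} {i : Fin n}
    (h : ∀ j, i < j → ∀ k, a (j, k) = b (j, k)) : tailIdeal a i = tailIdeal b i := by
  rw [tailIdeal, tailIdeal]
  congr 1
  exact Set.image_congr fun j hj => linForm_congr (h j hj)

theorem linForm_isHomogeneous (a : Fin n × Fin n → K) (j : Fin n) : (linForm a j).IsHomogeneous 1 :=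
  IsHomogeneous.sum _ _ _ fun k _ => (homogeneousSubmodule (Fin n) K 1).smul_mem _
    (isHomogeneous_X K k)

theorem linForm_mem_idealOfVars (a : Fin n × Fin n → K) (j : Fin n) :
    linForm a j ∈ idealOfVars (Fin n) K :=
  Submodule.sum_mem _ fun k _ => Submodule.smul_of_tower_mem _ _ (Ideal.subset_span ⟨k, rfl⟩)

theorem tailIdeal_le_idealOfVars (a : Fin n × Fin n → K) (i : Fin n) :
    tailIdeal a i ≤ idealOfVars (Fin n) K := by
  rw [tailIdeal, Ideal.span_le]
  rintro _ ⟨j, -, rfl⟩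
  exact linForm_mem_idealOfVars a j

theorem isHomogeneous_tailIdeal (a : Fin n × Fin n → K) (i : Fin n) :
    (tailIdeal a i).IsHomogeneous (homogeneousSubmodule (Fin n) K) := by
  refine Ideal.homogeneous_span _ _ ?_
  rintro _ ⟨j, -, rfl⟩
  exact ⟨1, linForm_isHomogeneous a j⟩

end Rows

theorem isHomogeneous_map {K L σ : Type*} [Field K] [Field L] (p : K →+* L)
    {I : Ideal (MvPolynomial σ K)} (hI : I.IsHomogeneous (homogeneousSubmodule σ K)) :
    (I.map (map p)).IsHomogeneous (homogeneousSubmodule σ L) := by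
  intro i f hf
  change (decomposition.decompose' f i : MvPolynomial σ L) ∈ _
  rw [decomposition.decompose'_apply]
  have hle : Submodule.span L (map p '' (I : Set (MvPolynomial σ K))) ≤
      ((I.map (map p)).restrictScalars L).comap (homogeneousComponent i) := by
    rw [Submodule.span_le]
    rintro _ ⟨h, hh, rfl⟩
    have : homogeneousComponent i (map p h) = map p (homogeneousComponent i h) := by
      ext c
      simp only [coeff_homogeneousComponent, coeff_map]
      split_ifs <;> simp
    rw [SetLike.mem_coe, Submodule.mem_comap, this]
    exact Ideal.mem_map_of_mem _ (homogeneousComponent_mem_of_mem hI hh i)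
  exact hle (mem_span_image_of_mem_map p I hf)

/-- The linear form whose coefficients are the entries of the `j`-th row of the generic matrix. -/
noncomputable def genericLinForm (K : Type*) [Field K] (n : ℕ) (j : Fin n) :
    MvPolynomial (Fin n) (MvPolynomial (Fin n × Fin n) K) :=
  ∑ k, C (X (j, k)) * X k

theorem map_genericLinForm {K L : Type*} [Field K] [Field L] {n : ℕ}
    (p : MvPolynomial (Fin n × Fin n) K →+* L) (j : Fin n) :
    map p (genericLinForm K n j) = ∑ k, C (p (X (j, k))) * X k := by
  simp [genericLinForm]

theorem map_linForm {K L : Type*} [Field K] [Field L] (p : K →+* L) {n : ℕ}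
    (a : Fin n × Fin n → K) (j : Fin n) : map p (linForm a j) = ∑ k, C (p (a (j, k))) * X k := by
  simp [linForm, smul_eq_C_mul]

/-- The family of the ideals `I ⊔ tailIdeal a i`. -/
noncomputable def genericTail {K : Type*} [Field K] {n : ℕ} (I : Ideal (MvPolynomial (Fin n) K))
    (i : Fin n) : Ideal (MvPolynomial (Fin n) (MvPolynomial (Fin n × Fin n) K)) :=
  I.map (map C) ⊔ Ideal.span (genericLinForm K n '' Set.Ioi i)

/-- Only scalars and the rows after `i` are prescribed. The row `i` stays free, so `p` can be a
rational point or can make the `i`-th form generic. -/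
theorem map_genericTail {K L : Type*} [Field K] [Field L] [Algebra K L] {n : ℕ}
    (I : Ideal (MvPolynomial (Fin n) K)) (i : Fin n) (a : Fin n × Fin n → K)
    (p : MvPolynomial (Fin n × Fin n) K →+* L) (hC : p.comp C = algebraMap K L)
    (hX : ∀ j, i < j → ∀ k, p (X (j, k)) = algebraMap K L (a (j, k))) :
    (genericTail I i).map (map p) = (I ⊔ tailIdeal a i).map (map (algebraMap K L)) := by
  have h : (map p).comp (map C) =
      (map (algebraMap K L) : MvPolynomial (Fin n) K →+* MvPolynomial (Fin n) L) := by
    refine RingHom.ext fun f => ?_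
    rw [RingHom.comp_apply, map_map, hC]
  rw [genericTail, Ideal.map_sup, Ideal.map_sup, Ideal.map_map, h, tailIdeal, Ideal.map_span,
    Ideal.map_span, ← Set.image_comp, ← Set.image_comp]
  congr 2
  refine Set.image_congr fun j hj => ?_
  rw [Function.comp_apply, Function.comp_apply, map_genericLinForm, map_linForm]
  exact Finset.sum_congr rfl fun k _ => by rw [hX j hj k]

/-- The `t`-value of a general section is constant, and it is the dimension of the kernel of the
multiplication by the next linear form. -/
theorem exists_generic_tValueSection {K : Type*} [Field K] [Infinite K] {n : ℕ}
    (I : Ideal (MvPolynomial (Fin n) K))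
    (hI : I.IsHomogeneous (homogeneousSubmodule (Fin n) K)) (i : Fin n) :
    ∃ (F : MvPolynomial (Fin n × Fin n) K) (r : ℕ), F ≠ 0 ∧ ∀ a : Fin n × Fin n → K,
      eval a F ≠ 0 → tValueSection I a i = r ∧
        FiniteDimensional K (mulKer (I ⊔ tailIdeal a i) (linForm a i)) ∧
        Module.finrank K (mulKer (I ⊔ tailIdeal a i) (linForm a i)) = r := by
  classical
  obtain ⟨F, u, hF, hu⟩ := exists_generic_finrank_mulKer (genericTail I i) (genericLinForm K n i)
  have hhom : ∀ a : Fin n × Fin n → K,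
      (I ⊔ tailIdeal a i).IsHomogeneous (homogeneousSubmodule (Fin n) K) := fun a =>
    Ideal.IsHomogeneous.sup hI (isHomogeneous_tailIdeal a i)
  -- rational points
  have hpt : ∀ a : Fin n × Fin n → K, eval a F ≠ 0 → ∀ D, Module.finrank K
      (degreeFiltration (I ⊔ tailIdeal a i) D ⊓
        mulKer (I ⊔ tailIdeal a i) (linForm a i) : Submodule K _) = u D := by
    intro a ha D
    have h1 : (genericTail I i).map (map (eval a)) = I ⊔ tailIdeal a i := by
      rw [map_genericTail I i a (eval a) (by ext; simp) (by simp), Algebra.algebraMap_self]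
      have : (map (RingHom.id K) : MvPolynomial (Fin n) K →+* _) = RingHom.id _ :=
        RingHom.ext fun f => map_id f
      rw [this, Ideal.map_id]
    have h2 : map (eval a) (genericLinForm K n i) = linForm a i := by
      rw [map_genericLinForm, linForm]
      simp [smul_eq_C_mul]
    have := hu K (eval a) ha
    rw [h1, h2] at this
    exact this (hhom a) (linForm_isHomogeneous a i) D
  obtain ⟨b, hb⟩ : ∃ b : Fin n × Fin n → K, eval b F ≠ 0 := by
    by_contra! h
    exact hF (MvPolynomial.funext fun v => by rw [h v, map_zero])
  -- Only row `i` of `b` is changed, which leaves the tail ideal alone, and the new row keeps `F`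
  -- nonzero.
  obtain ⟨v, hv, hfin⟩ := exists_finiteDimensional_mulKer (I ⊔ tailIdeal b i) _
    (substRow_ne_zero i hb)
  rw [eval_substRow] at hv
  have htail : tailIdeal (setRow b i v) i = tailIdeal b i :=
    tailIdeal_congr fun j hj k => by simp [setRow, hj.ne']
  have hlin := linForm_setRow_self b i v
  rw [← htail, ← hlin] at hfin
  obtain ⟨D, hD⟩ := exists_degreeFiltration_ge _ _ ((Submodule.fg_iff_finiteDimensional _).mpr hfin)
  set r := Module.finrank K
    (mulKer (I ⊔ tailIdeal (setRow b i v) i) (linForm (setRow b i v) i)) with hr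
  -- The kernel at this one point pins down the eventual value of `u` and the bound `D`, which then
  -- serve at all points.
  have hur : ∀ E, D ≤ E → u E = r := by
    intro E hE
    rw [← hpt _ hv E, inf_eq_right.mpr (hD.trans (degreeFiltration_mono _ hE))]
  refine ⟨F, r, hF, fun a ha => ?_⟩
  obtain ⟨hle, hrank⟩ := le_degreeFiltration_of_finrank_eq (I ⊔ tailIdeal a i)
    (mulKer (I ⊔ tailIdeal a i) (linForm a i)) D r
    (fun E hE => by rw [hpt a ha E, hur E hE])
  refine ⟨?_, Submodule.finiteDimensional_of_le hle, hrank⟩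
  -- the generic point of the section
  set L := FractionRing (MvPolynomial (Set.Iic i) K)
  -- Row `i` becomes `∑ X_j z_j` over `j ≤ i`, the form `Y` of the section; the other rows keep the
  -- entries of `a`.
  set q : MvPolynomial (Fin n × Fin n) K →+* MvPolynomial (Set.Iic i) K :=
    eval₂Hom C fun jk => if jk.1 = i then ∑ j : Set.Iic i, X j * C (a (j, jk.2)) else C (a jk)
    with hq
  set p : MvPolynomial (Fin n × Fin n) K →+* L :=
    (algebraMap (MvPolynomial (Set.Iic i) K) L).comp q with hp
  have hpC : p.comp C = algebraMap K L := by
    ext c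
    rw [hp, RingHom.comp_apply, RingHom.comp_apply, hq, coe_eval₂Hom, eval₂_C,
      IsScalarTower.algebraMap_apply K (MvPolynomial (Set.Iic i) K) L]
    rfl
  have hKL : ∀ c : K, algebraMap (MvPolynomial (Set.Iic i) K) L (C c) = algebraMap K L c :=
    fun c => (IsScalarTower.algebraMap_apply K (MvPolynomial (Set.Iic i) K) L c).symm
  have hpX : ∀ j, i < j → ∀ k, p (X (j, k)) = algebraMap K L (a (j, k)) := by
    intro j hj k
    rw [hp, RingHom.comp_apply, hq, coe_eval₂Hom, eval₂_X, if_neg (by simpa using hj.ne'), hKL]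
  have hpF : p F ≠ 0 := by
    rw [hp, RingHom.comp_apply]
    intro h
    rw [map_eq_zero_iff _ (IsFractionRing.injective (MvPolynomial (Set.Iic i) K) L)] at h
    -- Setting `X_i = 1` and the other `X_j = 0` recovers `a`, so `F a ≠ 0` shows that `F` does not
    -- vanish at the generic point.
    have h1 : (eval fun j : Set.Iic i => if (j : Fin n) = i then (1 : K) else 0).comp q =
        eval a := by
      apply MvPolynomial.ringHom_ext
      · intro c
        simp [hq]
      · rintro ⟨j, k⟩
        rw [RingHom.comp_apply, hq, coe_eval₂Hom, eval₂_X, eval_X]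
        by_cases hj : j = i
        · subst hj
          rw [if_pos rfl, map_sum, Finset.sum_eq_single ⟨j, Set.mem_Iic.mpr le_rfl⟩]
          · simp
          · intro l _ hl
            have : (l : Fin n) ≠ j := fun h => hl (Subtype.ext h)
            simp [this]
          · simp
        · rw [if_neg hj, eval_C]
    have h2 := DFunLike.congr_fun h1 F
    rw [RingHom.comp_apply, h, map_zero] at h2
    exact ha h2.symm
  have hmapT := map_genericTail I i a p hpC hpX
  have hw : map p (genericLinForm K n i) = ∑ j : Set.Iic i,
      C (algebraMap (MvPolynomial (Set.Iic i) K) L (X j)) *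
        map (algebraMap K L) (linForm a j) := by
    rw [map_genericLinForm]
    simp only [map_linForm, Finset.mul_sum]
    rw [Finset.sum_comm]
    refine Finset.sum_congr rfl fun k _ => ?_
    rw [hp, RingHom.comp_apply, hq, coe_eval₂Hom, eval₂_X, if_pos rfl, map_sum, map_sum,
      Finset.sum_mul]
    refine Finset.sum_congr rfl fun j _ => ?_
    rw [map_mul, map_mul, hKL, mul_assoc]
  have hhomL : ((genericTail I i).map (map p)).IsHomogeneous (homogeneousSubmodule (Fin n) L) := by
    rw [hmapT]
    exact isHomogeneous_map _ (hhom a)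
  have hwhom : (map p (genericLinForm K n i)).IsHomogeneous 1 := by
    rw [map_genericLinForm]
    refine IsHomogeneous.sum _ _ _ fun k _ => ?_
    rw [← smul_eq_C_mul]
    exact (homogeneousSubmodule (Fin n) L 1).smul_mem _ (isHomogeneous_X L k)
  obtain ⟨hleL, hrankL⟩ := le_degreeFiltration_of_finrank_eq ((genericTail I i).map (map p))
    (mulKer ((genericTail I i).map (map p)) (map p (genericLinForm K n i))) D r
    (fun E hE => by rw [hu L p hpF hhomL hwhom E, hur E hE])
  rw [← hrankL]
  exact tValue_quotient_eq_finrank (tailIdeal a i) I (tailIdeal_le_idealOfVars a i)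
    (fun j : Set.Iic i => linForm a j) L _ hmapT _ hw
    (Submodule.finiteDimensional_of_le hleL) (D + 1)
    (fun g hg f hf => mul_mem_of_mulKer_le_degreeFiltration hhomL hwhom hleL hg hf)

/-! ### Lengths of subquotients and sections by a linear form. -/

section Length

variable {K E F G : Type*} [Field K] [AddCommGroup E] [Module K E] [AddCommGroup F] [Module K F]
  [AddCommGroup G] [Module K G]

theorem length_eq_length_inf_ker_add_length_map (f : E →ₗ[K] F) (p : Submodule K E) :
    Module.length K p =
      Module.length K (p ⊓ LinearMap.ker f : Submodule K E) + Module.length K (p.map f) := by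
  refine Module.length_eq_add_of_exact
    (Submodule.inclusion (inf_le_left : p ⊓ LinearMap.ker f ≤ p))
    ((f.domRestrict p).codRestrict (p.map f) fun x => ⟨x, x.2, rfl⟩)
    (Submodule.inclusion_injective _) ?_ ?_
  · rintro ⟨_, x, hx, rfl⟩
    exact ⟨⟨x, hx⟩, rfl⟩
  · rintro ⟨x, hx⟩
    constructor
    · intro h
      exact ⟨⟨x, hx, congrArg Subtype.val h⟩, rfl⟩
    · rintro ⟨⟨y, hy⟩, h⟩
      rw [Subtype.ext_iff] at h
      change y = x at h
      subst h
      exact Subtype.ext hy.2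

theorem length_map_eq_length_map {f : E →ₗ[K] F} {g : E →ₗ[K] G} {p : Submodule K E}
    (h : p ⊓ LinearMap.ker f = p ⊓ LinearMap.ker g) :
    Module.length K (p.map f) = Module.length K (p.map g) := by
  have hker : LinearMap.ker (f.domRestrict p) = LinearMap.ker (g.domRestrict p) := by
    ext ⟨x, hx⟩
    have : x ∈ p ⊓ LinearMap.ker f ↔ x ∈ p ⊓ LinearMap.ker g := by rw [h]
    simpa [hx] using this
  rw [← LinearMap.range_domRestrict, ← LinearMap.range_domRestrict]
  exact ((f.domRestrict p).quotKerEquivRange.symm.trans ((Submodule.quotEquivOfEq _ _ hker).trans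
    (g.domRestrict p).quotKerEquivRange)).length_eq

end Length

section IdealLength

variable (K : Type*) {A : Type*} [Field K] [CommRing A] [Algebra K A]

/-- The dimension of `(U + V) / U` over `K`. -/
noncomputable def idealLength (U V : Ideal A) : ℕ∞ :=
  Module.length K ((V.restrictScalars K).map (Ideal.Quotient.mkₐ K U).toLinearMap)

variable {K}

theorem mem_ker_mkₐ {U : Ideal A} {f : A} :
    f ∈ LinearMap.ker (Ideal.Quotient.mkₐ K U).toLinearMap ↔ f ∈ U :=
  Ideal.Quotient.eq_zero_iff_mem

theorem idealLength_eq_zero_iff {U V : Ideal A} : idealLength K U V = 0 ↔ V ≤ U := by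
  rw [idealLength, Module.length_eq_zero_iff, Submodule.subsingleton_iff_eq_bot, ← le_bot_iff,
    Submodule.map_le_iff_le_comap]
  constructor
  · exact fun h f hf => mem_ker_mkₐ.mp (h hf)
  · exact fun h f hf => mem_ker_mkₐ.mpr (h hf)

theorem idealLength_add {U V W : Ideal A} (hUV : U ≤ V) (hVW : V ≤ W) :
    idealLength K U W = idealLength K U V + idealLength K V W := by
  set π : (A ⧸ U) →ₗ[K] (A ⧸ V) := (Ideal.Quotient.factorₐ K hUV).toLinearMap
  have h1 := length_eq_length_inf_ker_add_length_map π
    ((W.restrictScalars K).map (Ideal.Quotient.mkₐ K U).toLinearMap)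
  have h2 : ((W.restrictScalars K).map (Ideal.Quotient.mkₐ K U).toLinearMap).map π =
      (W.restrictScalars K).map (Ideal.Quotient.mkₐ K V).toLinearMap := by
    rw [← Submodule.map_comp]
    rfl
  have h3 : (W.restrictScalars K).map (Ideal.Quotient.mkₐ K U).toLinearMap ⊓ LinearMap.ker π =
      (V.restrictScalars K).map (Ideal.Quotient.mkₐ K U).toLinearMap := by
    apply le_antisymm
    · rintro _ ⟨⟨f, hf, rfl⟩, hfπ⟩
      exact ⟨f, Ideal.Quotient.eq_zero_iff_mem.mp hfπ, rfl⟩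
    · rintro _ ⟨f, hf, rfl⟩
      exact ⟨⟨f, hVW hf, rfl⟩, Ideal.Quotient.eq_zero_iff_mem.mpr hf⟩
  rw [h2, h3] at h1
  exact h1

/-- Second isomorphism theorem: `V` surjects onto `(V + W) / (U + W)` with kernel `V ∩ (U + W)`. -/
theorem idealLength_inf_sup (U V W : Ideal A) :
    idealLength K (V ⊓ (U ⊔ W)) V = idealLength K (U ⊔ W) (V ⊔ W) := by
  have h1 : ((V ⊔ W).restrictScalars K).map (Ideal.Quotient.mkₐ K (U ⊔ W)).toLinearMap =
      (V.restrictScalars K).map (Ideal.Quotient.mkₐ K (U ⊔ W)).toLinearMap := by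
    apply le_antisymm
    · rintro _ ⟨f, hf, rfl⟩
      obtain ⟨v, hv, w, hw, rfl⟩ := Submodule.mem_sup.mp hf
      refine ⟨v, hv, ?_⟩
      refine Ideal.Quotient.eq.mpr ?_
      rw [sub_add_cancel_left]
      exact Ideal.neg_mem_iff _ |>.mpr (Ideal.mem_sup_right hw)
    · exact Submodule.map_mono fun f hf => Ideal.mem_sup_left hf
  rw [idealLength, idealLength, h1]
  refine length_map_eq_length_map ?_
  ext f
  simp only [Submodule.mem_inf, mem_ker_mkₐ, Submodule.restrictScalars_mem]
  tauto

/-- Multiplication by `z` induces an isomorphism from `(V : z) / (U : z)` onto `(V ∩ (U + (z))) /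
U`. -/
theorem idealLength_inf_sup_span (U V : Ideal A) (z : A) (hU : U ≤ V) :
    idealLength K U (V ⊓ (U ⊔ Ideal.span {z})) = idealLength K (U.colon {z}) (V.colon {z}) := by
  set μ : A →ₗ[K] A ⧸ U := (Ideal.Quotient.mkₐ K U).toLinearMap.comp (LinearMap.mulLeft K z)
  have h1 : ((V ⊓ (U ⊔ Ideal.span {z})).restrictScalars K).map
      (Ideal.Quotient.mkₐ K U).toLinearMap = ((V.colon {z}).restrictScalars K).map μ := by
    apply le_antisymm
    · rintro _ ⟨f, ⟨hfV, hf⟩, rfl⟩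
      obtain ⟨u, hu, y, hy, rfl⟩ := Submodule.mem_sup.mp hf
      obtain ⟨r, rfl⟩ := Ideal.mem_span_singleton'.mp hy
      refine ⟨r, ?_, ?_⟩
      · refine Submodule.mem_colon_singleton.mpr ?_
        have := V.sub_mem hfV (hU hu)
        rwa [add_sub_cancel_left] at this
      · refine Ideal.Quotient.eq.mpr ?_
        rw [LinearMap.mulLeft_apply, mul_comm, sub_add_cancel_right]
        exact (Ideal.neg_mem_iff _).mpr hu
    · rintro _ ⟨r, hr, rfl⟩
      have hr := Submodule.mem_colon_singleton.mp hr
      refine ⟨z * r, ⟨?_, ?_⟩, rfl⟩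
      · rw [mul_comm]
        exact hr
      · exact Ideal.mem_sup_right (Ideal.mul_mem_right _ _ (Ideal.mem_span_singleton_self z))
  rw [idealLength, h1, idealLength]
  refine length_map_eq_length_map ?_
  ext r
  simp only [Submodule.mem_inf, mem_ker_mkₐ, Submodule.restrictScalars_mem]
  refine and_congr_right fun _ => ?_
  rw [Submodule.mem_colon_singleton, smul_eq_mul, mul_comm]
  exact Ideal.Quotient.eq_zero_iff_mem

/-- Comparison of the lengths of `V / U` and of its image modulo `z`. -/
theorem idealLength_add_idealLength_colon (U V : Ideal A) (z : A) (hU : U ≤ V)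
    (hz : V ≤ U.colon {z}) :
    idealLength K U V + idealLength K V (U.colon {z}) =
      idealLength K (U ⊔ Ideal.span {z}) (V ⊔ Ideal.span {z}) + idealLength K V (V.colon {z}) := by
  -- Insert `V ∩ (U + (z))` between `U` and `V`, and `U : z` between `V` and `V : z`; both sides
  -- become the same sum, with no subtraction in `ℕ∞`.
  rw [idealLength_add (le_inf hU le_sup_left : U ≤ V ⊓ (U ⊔ Ideal.span {z})) inf_le_left,
    idealLength_inf_sup U V, idealLength_inf_sup_span U V z hU,
    idealLength_add hz (Submodule.colon_mono hU subset_rfl)]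
  abel

end IdealLength

theorem idealLength_colon_eq_finrank {K σ : Type*} [Field K] (J : Ideal (MvPolynomial σ K))
    (z : MvPolynomial σ K) [FiniteDimensional K (mulKer J z)] :
    idealLength K J (J.colon {z}) = Module.finrank K (mulKer J z) := by
  have : ((J.colon {z}).restrictScalars K).map (Ideal.Quotient.mkₐ K J).toLinearMap =
      mulKer J z := by
    ext x
    obtain ⟨f, rfl⟩ := Ideal.Quotient.mk_surjective x
    rw [mk_mem_mulKer]
    constructor
    · rintro ⟨g, hg, hgf⟩
      have hg := Submodule.mem_colon_singleton.mp hg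
      have hgf := Ideal.Quotient.eq.mp hgf
      have := J.sub_mem hg (J.mul_mem_left z hgf)
      rwa [smul_eq_mul, mul_sub, mul_comm g z, sub_sub_cancel] at this
    · intro h
      exact ⟨f, Submodule.mem_colon_singleton.mpr (by rwa [smul_eq_mul, mul_comm]), rfl⟩
  rw [idealLength, this, Module.length_eq_finrank]

/-! ### Minimal generators and the graded Nakayama lemma. -/

section Generators

variable {K σ : Type*} [Field K]

/-- Graded Nakayama, by induction on the degree: the component of degree `d + 1` of an element of
`𝔪I` is built from components of degree `d` of elements of `I`. -/
theorem le_of_le_sup_idealOfVars_mul {I I' : Ideal (MvPolynomial σ K)}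
    (hI' : I'.IsHomogeneous (homogeneousSubmodule σ K))
    (h : I ≤ I' ⊔ idealOfVars σ K * I) : I ≤ I' := by
  have key : ∀ d, ∀ f ∈ I, homogeneousComponent d f ∈ I' := by
    intro d
    induction d with
    | zero =>
      intro f hf
      obtain ⟨g, hg, y, hy, rfl⟩ := Submodule.mem_sup.mp (h hf)
      rw [map_add]
      refine I'.add_mem (homogeneousComponent_mem_of_mem hI' hg 0) ?_
      have : homogeneousComponent 0 y = 0 := by
        have hy : y ∈ idealOfVars σ K := Ideal.mul_le_left hy
        rw [← pow_one (idealOfVars σ K), mem_pow_idealOfVars_iff'] at hy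
        rw [homogeneousComponent_zero, hy 0 (by simp), map_zero]
      rw [this]
      exact I'.zero_mem
    | succ d ih =>
      intro f hf
      obtain ⟨g, hg, y, hy, rfl⟩ := Submodule.mem_sup.mp (h hf)
      rw [map_add]
      refine I'.add_mem (homogeneousComponent_mem_of_mem hI' hg _) ?_
      clear hf
      induction hy using Submodule.mul_induction_on' with
      | mem_mul_mem r hr w hw =>
        induction hr using Submodule.span_induction generalizing w with
        | mem x hx =>
          obtain ⟨k, rfl⟩ := hx
          rw [homogeneousComponent_succ_mul (isHomogeneous_X K k)]
          exact I'.mul_mem_left _ (ih w hw)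
        | zero => rw [zero_mul, map_zero]; exact I'.zero_mem
        | add x y _ _ hx hy =>
          rw [add_mul, map_add]
          exact I'.add_mem (hx w hw) (hy w hw)
        | smul c x _ hx =>
          rw [smul_eq_mul, mul_comm c, mul_assoc]
          exact hx _ (I.mul_mem_left c hw)
      | add x hx y hy h1 h2 =>
        rw [map_add]
        exact I'.add_mem h1 h2
  intro f hf
  rw [mem_iff_homogeneousComponent_mem hI']
  exact fun d => key d f hf

/-- Any generators of `I` span `I / 𝔪I` over `K`, homogeneous or not. Conversely, homogeneous
elements span it as `I` is graded, so a basis lifts to homogeneous elements, and these generate `I`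
by Nakayama. -/
theorem spanFinrank_eq_idealLength [Finite σ] {I : Ideal (MvPolynomial σ K)}
    (hI : I.IsHomogeneous (homogeneousSubmodule σ K)) :
    (I.spanFinrank : ℕ∞) = idealLength K (idealOfVars σ K * I) I := by
  classical
  set m := idealOfVars σ K
  set V := (I.restrictScalars K).map (Ideal.Quotient.mkₐ K (m * I)).toLinearMap
  have hfg : I.FG := IsNoetherian.noetherian I
  obtain ⟨s, hs, hspan⟩ := Submodule.FG.exists_span_finset_card_eq_spanFinrank hfg
  have hVs : V ≤ Submodule.span K ((s.image (Ideal.Quotient.mk (m * I)) : Finset _) : Set _) := by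
    rintro _ ⟨f, hf, rfl⟩
    rw [SetLike.mem_coe, Submodule.restrictScalars_mem, ← hspan] at hf
    induction hf using Submodule.span_induction with
    | mem x hx =>
      exact Submodule.subset_span (Finset.mem_coe.mpr (Finset.mem_image_of_mem _ hx))
    | zero => rw [map_zero]; exact Submodule.zero_mem _
    | add x y _ _ hx hy => rw [map_add]; exact Submodule.add_mem _ hx hy
    | smul c x hx h =>
      have hxI : x ∈ I := hspan ▸ hx
      have h1 : (Ideal.Quotient.mkₐ K (m * I)).toLinearMap (c • x) =
          constantCoeff c • (Ideal.Quotient.mkₐ K (m * I)).toLinearMap x := by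
        rw [← map_smul]
        refine Ideal.Quotient.eq.mpr ?_
        rw [smul_eq_mul, smul_eq_C_mul, ← sub_mul]
        exact Ideal.mul_mem_mul (sub_C_constantCoeff_mem_idealOfVars c) hxI
      rw [h1]
      exact Submodule.smul_mem _ _ h
  have : FiniteDimensional K V := Submodule.finiteDimensional_of_le hVs
  have hle1 : Module.finrank K V ≤ I.spanFinrank := by
    refine (Submodule.finrank_mono hVs).trans ((finrank_span_finset_le_card _).trans ?_)
    rw [← hs]
    exact Finset.card_image_le
  set H : Set (MvPolynomial σ K) := {f | f ∈ I ∧ ∃ d, f.IsHomogeneous d}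
  obtain ⟨b, hbH, hbspan, hbli⟩ := exists_linearIndependent K (Ideal.Quotient.mk (m * I) '' H)
  have hHV : Submodule.span K (Ideal.Quotient.mk (m * I) '' H) = V := by
    apply le_antisymm
    · rw [Submodule.span_le]
      rintro _ ⟨f, hf, rfl⟩
      exact ⟨f, hf.1, rfl⟩
    · rintro _ ⟨f, hf, rfl⟩
      rw [← sum_homogeneousComponent f, map_sum]
      exact Submodule.sum_mem _ fun d _ => Submodule.subset_span
        ⟨_, ⟨homogeneousComponent_mem_of_mem hI hf d, d, homogeneousComponent_isHomogeneous d f⟩,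
          rfl⟩
  rw [hHV] at hbspan
  have hbV : Submodule.span K (Set.range ((↑) : b → MvPolynomial σ K ⧸ m * I)) = V := by
    rw [Subtype.range_coe, hbspan]
  let B := (Module.Basis.span hbli).map (LinearEquiv.ofEq _ _ hbV)
  have hbfin : b.Finite := Module.Finite.finite_basis B
  have hbcard : b.ncard = Module.finrank K V := by
    rw [Module.finrank_eq_nat_card_basis B]
    rfl
  choose! c hcH hcb using (fun x hx => hbH hx : ∀ x ∈ b, ∃ f ∈ H, Ideal.Quotient.mk (m * I) f = x)
  have hgen : I ≤ Ideal.span (c '' b) := by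
    refine le_of_le_sup_idealOfVars_mul (Ideal.homogeneous_span _ _ ?_) fun f hf => ?_
    · rintro _ ⟨x, hx, rfl⟩
      exact (hcH x hx).2
    · have h1 : Ideal.Quotient.mk (m * I) f ∈ Submodule.span K b := by
        rw [hbspan]
        exact ⟨f, hf, rfl⟩
      have h2 : Submodule.span K b ≤ ((Ideal.span (c '' b)).restrictScalars K).map
          (Ideal.Quotient.mkₐ K (m * I)).toLinearMap := by
        rw [Submodule.span_le]
        exact fun x hx => ⟨c x, Ideal.subset_span ⟨x, hx, rfl⟩, hcb x hx⟩
      obtain ⟨g, hg, hgf⟩ := h2 h1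
      rw [← add_sub_cancel g f]
      refine Submodule.add_mem_sup hg ?_
      rw [← neg_sub]
      exact (Ideal.neg_mem_iff _).mpr (Ideal.Quotient.eq.mp hgf)
  have hgen' : Ideal.span (c '' b) = I := by
    refine le_antisymm (Ideal.span_le.mpr ?_) hgen
    rintro _ ⟨x, hx, rfl⟩
    exact (hcH x hx).1
  have hle2 : I.spanFinrank ≤ Module.finrank K V := by
    rw [← hbcard]
    refine (congrArg Submodule.spanFinrank hgen').symm.trans_le ?_
    exact (Submodule.spanFinrank_span_le_ncard_of_finite (hbfin.image c)).trans
      (Set.ncard_image_le hbfin)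
  rw [idealLength, Module.length_eq_finrank, le_antisymm hle2 hle1]

end Generators

/-! ### Telescoping along the sections. -/

section LinearSections

variable {K : Type*} [Field K] {n : ℕ}

/-- The ideal generated by the linear forms with index at least `d`. -/
noncomputable def tailSpan (a : Fin n × Fin n → K) (d : ℕ) : Ideal (MvPolynomial (Fin n) K) :=
  Ideal.span (linForm a '' {j | d ≤ (j : ℕ)})

theorem tailSpan_succ (a : Fin n × Fin n → K) (i : Fin n) :
    tailSpan a (i + 1) = tailIdeal a i := by
  rw [tailSpan, tailIdeal]
  congr 2

theorem tailSpan_coe (a : Fin n × Fin n → K) (i : Fin n) :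
    tailSpan a i = tailSpan a (i + 1) ⊔ Ideal.span {linForm a i} := by
  have : {j : Fin n | (i : ℕ) ≤ j} = {j : Fin n | (i : ℕ) + 1 ≤ j} ∪ {i} := by
    ext j
    simp only [Set.mem_ofPred_eq, Set.mem_union, Set.mem_singleton_iff, Fin.ext_iff]
    omega
  rw [tailSpan, this, Set.image_union, Set.image_singleton, Ideal.span_union, tailSpan]

theorem tailSpan_card (a : Fin n × Fin n → K) : tailSpan a n = ⊥ := by
  have : {j : Fin n | n ≤ (j : ℕ)} = ∅ := by
    ext j
    simp
  rw [tailSpan, this, Set.image_empty, Ideal.span_empty]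

theorem tailSpan_zero (a : Fin n × Fin n → K) :
    tailSpan a 0 = Ideal.span (Set.range (linForm a)) := by
  simp [tailSpan]

theorem tailSpan_congr {a b : Fin n × Fin n → K} {d : ℕ}
    (h : ∀ j : Fin n, d ≤ (j : ℕ) → ∀ k, a (j, k) = b (j, k)) : tailSpan a d = tailSpan b d := by
  rw [tailSpan, tailSpan]
  congr 1
  exact Set.image_congr fun j hj => linForm_congr (h j hj)

theorem idealOfVars_mul_sup_sup (I T : Ideal (MvPolynomial (Fin n) K)) :
    idealOfVars (Fin n) K * (I ⊔ T) ⊔ T = idealOfVars (Fin n) K * I ⊔ T := by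
  rw [Ideal.mul_sup, sup_assoc, sup_eq_right.mpr
      (Ideal.mul_le_right : idealOfVars (Fin n) K * T ≤ T)]

theorem sup_le_colon_linForm (I T : Ideal (MvPolynomial (Fin n) K)) (a : Fin n × Fin n → K)
    (i : Fin n) : I ⊔ T ≤ (idealOfVars (Fin n) K * I ⊔ T).colon {linForm a i} := by
  refine sup_le (fun f hf => ?_) fun f hf => ?_
  · refine Submodule.mem_colon_singleton.mpr (Ideal.mem_sup_left ?_)
    rw [smul_eq_mul, mul_comm f]
    exact Ideal.mul_mem_mul (linForm_mem_idealOfVars a i) hf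
  · exact Submodule.mem_colon_singleton.mpr (Ideal.mem_sup_right (T.mul_mem_right _ hf))

/-- Telescoping without cancellation, since the lengths live in `ℕ∞`. -/
theorem add_sum_eq_add_sum {M : Type*} [AddCommMonoid M] {n : ℕ} (u : ℕ → M) (c t : Fin n → M)
    (h : ∀ i : Fin n, u (i + 1) + c i = u i + t i) : u n + ∑ i, c i = u 0 + ∑ i, t i := by
  induction n with
  | zero => simp
  | succ n ih =>
    have h1 := ih (fun i => c i.castSucc) (fun i => t i.castSucc) fun i => h i.castSucc
    have h2 := h (Fin.last n)
    rw [Fin.val_last] at h2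
    rw [Fin.sum_univ_castSucc, Fin.sum_univ_castSucc, ← add_assoc (u 0), ← h1,
      add_comm _ (c _), ← add_assoc, h2]
    abel

/-- The number of generators of `I` and the lengths of the kernels of the linear forms of a
sequence of sections. -/
theorem spanFinrank_add_sum_idealLength {I : Ideal (MvPolynomial (Fin n) K)}
    (hI : I.IsHomogeneous (homogeneousSubmodule (Fin n) K)) (hIm : I ≤ idealOfVars (Fin n) K)
    {a : Fin n × Fin n → K} (ha : tailSpan a 0 = idealOfVars (Fin n) K) :
    (I.spanFinrank : ℕ∞) + ∑ i : Fin n, idealLength K (I ⊔ tailSpan a (i + 1))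
        ((idealOfVars (Fin n) K * I ⊔ tailSpan a (i + 1)).colon {linForm a i}) =
      ∑ i : Fin n, idealLength K (I ⊔ tailSpan a (i + 1))
        ((I ⊔ tailSpan a (i + 1)).colon {linForm a i}) := by
  have h := add_sum_eq_add_sum
    (fun d => idealLength K (idealOfVars (Fin n) K * I ⊔ tailSpan a d) (I ⊔ tailSpan a d))
    (fun i : Fin n => idealLength K (I ⊔ tailSpan a (i + 1))
        ((idealOfVars (Fin n) K * I ⊔ tailSpan a (i + 1)).colon {linForm a i}))
    (fun i : Fin n => idealLength K (I ⊔ tailSpan a (i + 1))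
        ((I ⊔ tailSpan a (i + 1)).colon {linForm a i})) fun i => by
      have := idealLength_add_idealLength_colon (K := K)
        (idealOfVars (Fin n) K * I ⊔ tailSpan a (i + 1))
        (I ⊔ tailSpan a (i + 1)) (linForm a i) (sup_le_sup_right Ideal.mul_le_right _)
        (sup_le_colon_linForm I _ a i)
      rwa [sup_assoc, sup_assoc, ← tailSpan_coe] at this
  -- In the last section everything inside `𝔪` vanishes; for `I = R` this term would not.
  have h0 : idealLength K (idealOfVars (Fin n) K * I ⊔ tailSpan a 0) (I ⊔ tailSpan a 0) = 0 := by
    rw [idealLength_eq_zero_iff, ha]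
    exact sup_le (hIm.trans le_sup_right) le_sup_right
  simp only [h0, zero_add, tailSpan_card, sup_bot_eq, ← spanFinrank_eq_idealLength hI] at h
  exact h

theorem span_range_linForm_eq {a : Fin n × Fin n → K}
    (ha : (Matrix.of fun i j => a (i, j)).det ≠ 0) :
    Ideal.span (Set.range (linForm a)) = idealOfVars (Fin n) K := by
  apply le_antisymm
  · rw [Ideal.span_le]
    rintro _ ⟨j, rfl⟩
    exact linForm_mem_idealOfVars a j
  · rw [idealOfVars, Ideal.span_le]
    rintro _ ⟨k, rfl⟩
    set M := Matrix.of fun i j => a (i, j)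
    have h : (X k : MvPolynomial (Fin n) K) = ∑ j, C (M⁻¹ k j) * linForm a j := by
      have hM : M⁻¹ * M = 1 := Matrix.nonsing_inv_mul M (isUnit_iff_ne_zero.mpr ha)
      have h1 : ∀ l, ∑ j, M⁻¹ k j * a (j, l) = if k = l then 1 else 0 := fun l => by
        rw [← Matrix.one_apply, ← hM, Matrix.mul_apply]
        rfl
      simp only [linForm, Finset.mul_sum, smul_eq_C_mul]
      rw [Finset.sum_comm]
      simp only [← mul_assoc, ← C_mul, ← Finset.sum_mul, ← map_sum, h1]
      simp
    rw [h]
    exact Submodule.sum_mem _ fun j _ => Ideal.mul_mem_left _ _ (Ideal.subset_span ⟨j, rfl⟩)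

theorem exists_eval_ne_zero {σ : Type*} [Infinite K] {F : MvPolynomial σ K} (hF : F ≠ 0) :
    ∃ a, eval a F ≠ 0 := by
  by_contra! h
  exact hF (MvPolynomial.funext fun a => by rw [h a, map_zero])

/-- For general linear forms all sections of `I` have the same lengths. -/
theorem exists_generic_tSequence [Infinite K] {I : Ideal (MvPolynomial (Fin n) K)}
    (hI : I.IsHomogeneous (homogeneousSubmodule (Fin n) K)) :
    ∃ (F : MvPolynomial (Fin n × Fin n) K) (t : Fin n → ℕ), F ≠ 0 ∧ ∀ a, eval a F ≠ 0 →
      tailSpan a 0 = idealOfVars (Fin n) K ∧ ∀ i, tValueSection I a i = t i ∧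
        idealLength K (I ⊔ tailSpan a (i + 1))
          ((I ⊔ tailSpan a (i + 1)).colon {linForm a i}) = t i := by
  choose F t hF0 hF using exists_generic_tValueSection I hI
  refine ⟨(∏ i, F i) * (Matrix.mvPolynomialX (Fin n) (Fin n) K).det, t,
    mul_ne_zero (Finset.prod_ne_zero_iff.mpr fun i _ => hF0 i)
      (Matrix.det_mvPolynomialX_ne_zero (Fin n) K), fun a ha => ?_⟩
  rw [map_mul, map_prod] at ha
  have h1 := Finset.prod_ne_zero_iff.mp (left_ne_zero_of_mul ha)
  have h2 := right_ne_zero_of_mul ha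
  refine ⟨?_, fun i => ?_⟩
  · rw [tailSpan_zero]
    apply span_range_linForm_eq
    rw [RingHom.map_det] at h2
    convert h2
    ext i j
    simp
  · obtain ⟨h3, h4, h5⟩ := hF i a (h1 i (Finset.mem_univ i))
    refine ⟨h3, ?_⟩
    rw [tailSpan_succ, idealLength_colon_eq_finrank, h5]

end LinearSections

/-! ### The recursion for complete `𝔪`-fullness and joint generality. -/

section MFull

variable {K : Type*} [Field K] {n : ℕ}

/-- The recursion of `IsCompletelyMFullAux` for the image of `J ⊇ T` in
`K[x_1, …, x_n] ⧸ T`. -/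
def SectionMFull : ℕ → Ideal (MvPolynomial (Fin n) K) → Ideal (MvPolynomial (Fin n) K) → Prop
  | 0, T, J => J = T
  | d + 1, T, J => HoldsGenerally fun v : Fin n → K =>
      (idealOfVars (Fin n) K * J ⊔ T).colon {∑ k, v k • X k} = J ∧
        SectionMFull d (T ⊔ Ideal.span {∑ k, v k • X k}) (J ⊔ Ideal.span {∑ k, v k • X k})

/-- Iterated quotient rings are traded for pairs of ideals in one polynomial ring. Pulling back
along the surjection `f` is injective on ideals, commutes with colons, and turns `𝔪I` into `𝔪` times
the preimage plus the kernel; passing to the quotient by `z` adds `z` to the kernel. -/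
theorem isCompletelyMFullAux_iff (d : ℕ) {A : Type*} [CommRing A] [Algebra K A]
    (f : MvPolynomial (Fin n) K →ₐ[K] A) (hf : Function.Surjective f) (I : Ideal A) :
    IsCompletelyMFullAux K d A (fun i => f (X i)) I ↔
      SectionMFull d (RingHom.ker f) (I.comap f) := by
  induction d generalizing A with
  | zero =>
    rw [IsCompletelyMFullAux, SectionMFull, RingHom.ker_eq_comap_bot]
    exact (Ideal.comap_injective_of_surjective f hf).eq_iff.symm
  | succ d ih =>
    rw [IsCompletelyMFullAux, SectionMFull]
    refine iff_of_eq (congrArg HoldsGenerally (funext fun v => propext ?_))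
    have hker : ∀ J : Ideal (MvPolynomial (Fin n) K), (J.map f).comap f = J ⊔ RingHom.ker f :=
      fun J => by rw [Ideal.comap_map_of_surjective f hf, RingHom.ker_eq_comap_bot]
    have hz : ∑ i, v i • f (X i) = f (∑ i, v i • X i) := by simp
    set w : A := ∑ i, v i • f (X i)
    set z : MvPolynomial (Fin n) K := ∑ i, v i • X i
    have hspan : Ideal.span {w} = (Ideal.span {z}).map f := by
      rw [hz, Ideal.map_span, Set.image_singleton]
    have hmap : (I.comap f).map f = I := Ideal.map_comap_of_surjective f hf I
    refine and_congr ?_ ?_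
    · change Submodule.colon _ {w} = I ↔ _
      rw [hz, ← (Ideal.comap_injective_of_surjective f hf).eq_iff]
      have h1 : (Ideal.span (Set.range fun i => f (X i)) * I).comap f =
          idealOfVars (Fin n) K * I.comap f ⊔ RingHom.ker f := by
        rw [← hker, Ideal.map_mul, hmap, idealOfVars, Ideal.map_span, ← Set.range_comp]
        rfl
      rw [← h1]
      have h2 : ((Ideal.span (Set.range fun i => f (X i)) * I).colon {f z}).comap f =
          ((Ideal.span (Set.range fun i => f (X i)) * I).comap f).colon {z} := by
        ext x
        simp only [Ideal.mem_comap, Submodule.mem_colon_singleton, smul_eq_mul, map_mul]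
      rw [h2]
    · have h := ih ((Ideal.Quotient.mkₐ K (Ideal.span {w})).comp f)
        (Ideal.Quotient.mk_surjective.comp hf) (I.map (Ideal.Quotient.mk (Ideal.span {w})))
      have h3 : RingHom.ker ((Ideal.Quotient.mkₐ K (Ideal.span {w})).comp f) =
          RingHom.ker f ⊔ Ideal.span {z} := by
        rw [sup_comm, ← hker, ← hspan]
        ext x
        exact Ideal.Quotient.eq_zero_iff_mem
      have h4 : (I.map (Ideal.Quotient.mk (Ideal.span {w}))).comap
          ((Ideal.Quotient.mkₐ K (Ideal.span {w})).comp f) = I.comap f ⊔ Ideal.span {z} := by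
        have h5 : ((I.map (Ideal.Quotient.mk (Ideal.span {w}))).comap
            (Ideal.Quotient.mk (Ideal.span {w}))).comap f = I.comap f ⊔ Ideal.span {z} := by
          rw [Ideal.comap_map_of_surjective _ Ideal.Quotient.mk_surjective,
            ← RingHom.ker_eq_comap_bot, Ideal.mk_ker, hspan, ← congrArg (· ⊔ _) hmap,
            ← Ideal.map_sup, hker]
          refine sup_eq_left.mpr (le_sup_of_le_left ?_)
          rw [RingHom.ker_eq_comap_bot]
          exact Ideal.comap_mono bot_le
        exact h5
      rw [h3, h4] at h
      exact h

theorem isCompletelyMFull_iff (I : Ideal (MvPolynomial (Fin n) K)) :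
    IsCompletelyMFull I ↔ SectionMFull n ⊥ I := by
  have h := isCompletelyMFullAux_iff n (AlgHom.id K (MvPolynomial (Fin n) K))
    Function.surjective_id I
  have h1 : RingHom.ker (AlgHom.id K (MvPolynomial (Fin n) K)) = ⊥ := by
    ext x
    exact Iff.rfl
  rw [h1] at h
  exact h

/-- The condition `𝔪 I : z = I` in the section of `I` defined by the linear forms after the
`i`-th one. -/
def ColonCondition (I : Ideal (MvPolynomial (Fin n) K)) (a : Fin n × Fin n → K) (i : Fin n) :
    Prop :=
  (idealOfVars (Fin n) K * I ⊔ tailSpan a (i + 1)).colon {linForm a i} = I ⊔ tailSpan a (i + 1)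

theorem colonCondition_iff {I : Ideal (MvPolynomial (Fin n) K)} {a : Fin n × Fin n → K}
    {i : Fin n} : ColonCondition I a i ↔ idealLength K (I ⊔ tailSpan a (i + 1))
      ((idealOfVars (Fin n) K * I ⊔ tailSpan a (i + 1)).colon {linForm a i}) = 0 := by
  rw [idealLength_eq_zero_iff]
  exact ⟨le_of_eq, fun h => le_antisymm h (sup_le_colon_linForm I _ a i)⟩

theorem ColonCondition.congr {I : Ideal (MvPolynomial (Fin n) K)} {a b : Fin n × Fin n → K}
    {i : Fin n} (h : ∀ j : Fin n, i ≤ j → ∀ k, a (j, k) = b (j, k)) (ha : ColonCondition I a i) :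
    ColonCondition I b i := by
  have h1 : tailSpan a (i + 1) = tailSpan b (i + 1) :=
    tailSpan_congr fun j hj => h j (Nat.le_of_succ_le hj)
  rwa [ColonCondition, h1, linForm_congr (h i le_rfl)] at ha

theorem setRow_of_lt {K : Type*} {n : ℕ} {b : Fin n × Fin n → K} {i j : Fin n} (v : Fin n → K)
    (hj : i < j) (k : Fin n) : setRow b i v (j, k) = b (j, k) :=
  if_neg hj.ne'

/-- From joint to successive generality: with the other rows of `a` fixed, the condition on row `d`
is `F` restricted to that row, a nonzero polynomial because `F a ≠ 0`. The rows below `d` are not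
yet used by the tail. -/
theorem sectionMFull_of_forall_colonCondition {I : Ideal (MvPolynomial (Fin n) K)}
    {F : MvPolynomial (Fin n × Fin n) K}
    (hF : ∀ a, eval a F ≠ 0 → I ≤ tailSpan a 0 ∧ ∀ i, ColonCondition I a i) {d : ℕ} (hd : d ≤ n) :
    ∀ a, eval a F ≠ 0 → SectionMFull d (tailSpan a d) (I ⊔ tailSpan a d) := by
  induction d with
  | zero => exact fun a ha => sup_eq_right.mpr (hF a ha).1
  | succ d ih =>
    intro a ha
    set i : Fin n := ⟨d, hd⟩
    refine ⟨substRow a i F, substRow_ne_zero i ha, fun v hv => ?_⟩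
    rw [eval_substRow] at hv
    have h1 : tailSpan (setRow a i v) (i + 1) = tailSpan a (d + 1) :=
      tailSpan_congr fun j hj => setRow_of_lt v hj
    have h2 := (hF _ hv).2 i
    have h3 := ih (Nat.le_of_succ_le hd) _ hv
    have h4 := tailSpan_coe (setRow a i v) i
    rw [h1, linForm_setRow_self] at h4
    change tailSpan (setRow a i v) d = _ at h4
    rw [ColonCondition, h1, linForm_setRow_self] at h2
    rw [h4, ← sup_assoc] at h3
    rw [idealOfVars_mul_sup_sup]
    exact ⟨h2, h3⟩

/-- From successive to joint generality, at one point: rows are chosen from the last downwards, each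
in the open set of the recursion and with `F` kept nonzero. Later choices change only earlier rows,
on which the conditions already secured do not depend. -/
theorem exists_colonCondition_of_sectionMFull [Infinite K] {I : Ideal (MvPolynomial (Fin n) K)}
    {F : MvPolynomial (Fin n × Fin n) K} {d : ℕ} (hd : d ≤ n) :
    ∀ a, eval a F ≠ 0 → SectionMFull d (tailSpan a d) (I ⊔ tailSpan a d) →
      ∃ b, eval b F ≠ 0 ∧ (∀ j : Fin n, d ≤ (j : ℕ) → ∀ k, a (j, k) = b (j, k)) ∧
        I ≤ tailSpan b 0 ∧ ∀ j : Fin n, (j : ℕ) < d → ColonCondition I b j := by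
  induction d with
  | zero =>
    exact fun a ha h => ⟨a, ha, fun _ _ _ => rfl, sup_eq_right.mp h,
        fun j hj => absurd hj (by simp)⟩
  | succ d ih =>
    rintro a ha ⟨G, hG0, hG⟩
    set i : Fin n := ⟨d, hd⟩
    obtain ⟨v, hv⟩ := exists_eval_ne_zero (mul_ne_zero (substRow_ne_zero i ha) hG0)
    rw [map_mul, eval_substRow] at hv
    obtain ⟨h2, h3⟩ := hG v (right_ne_zero_of_mul hv)
    have h1 : tailSpan (setRow a i v) (i + 1) = tailSpan a (d + 1) :=
      tailSpan_congr fun j hj => setRow_of_lt v hj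
    have h4 := tailSpan_coe (setRow a i v) i
    rw [h1, linForm_setRow_self] at h4
    change tailSpan (setRow a i v) d = _ at h4
    rw [sup_assoc, ← h4] at h3
    rw [idealOfVars_mul_sup_sup] at h2
    have h5 : ColonCondition I (setRow a i v) i := by
      rwa [ColonCondition, h1, linForm_setRow_self]
    obtain ⟨b, hb, hab, hIb, hcol⟩ := ih (Nat.le_of_succ_le hd) _ (left_ne_zero_of_mul hv) h3
    refine ⟨b, hb, fun j hj k => ?_, hIb, fun j hj => ?_⟩
    · rw [← hab j (Nat.le_of_succ_le hj) k, setRow_of_lt v hj]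
    · rcases Nat.lt_succ_iff_lt_or_eq.mp hj with hj | hj
      · exact hcol j hj
      · obtain rfl : j = i := Fin.ext hj
        exact h5.congr hab

end MFull

/-! ### The main theorem. -/

theorem le_idealOfVars_of_ne_top {K σ : Type*} [Field K] {I : Ideal (MvPolynomial σ K)}
    (hI : I.IsHomogeneous (homogeneousSubmodule σ K)) (h : I ≠ ⊤) : I ≤ idealOfVars σ K := by
  intro f hf
  have h1 := sub_C_constantCoeff_mem_idealOfVars f
  have h2 : C (constantCoeff f) ∈ I := by
    have := homogeneousComponent_mem_of_mem hI hf 0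
    rwa [homogeneousComponent_zero] at this
  have h3 : constantCoeff f = 0 := by
    by_contra h0
    exact h (Ideal.eq_top_of_isUnit_mem _ h2 ((isUnit_iff_ne_zero.mpr h0).map C))
  rwa [h3, map_zero, sub_zero] at h1

theorem theorem4p1 {K : Type*} [Field K] [Infinite K] (n : ℕ)
    (I : Ideal (MvPolynomial (Fin n) K))
    (hI : I.IsHomogeneous (MvPolynomial.homogeneousSubmodule (Fin n) K)) :
    (∃! t : Fin n → ℕ, IsTSequence I t) ∧
    ∀ t : Fin n → ℕ, IsTSequence I t →
      (IsCompletelyMFull I ↔ I.spanFinrank = ∑ i, t i) ∧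
      (I ≠ ⊤ → I.spanFinrank ≤ ∑ i, t i) := by
  obtain ⟨F, r, hF0, hF⟩ := exists_generic_tSequence hI
  have huniq : ∀ t, IsTSequence I t → t = r := by
    rintro t ⟨G, hG0, hG⟩
    -- Two nonempty open sets meet, as `K` is infinite.
    obtain ⟨a, ha⟩ := exists_eval_ne_zero (mul_ne_zero hF0 hG0)
    rw [map_mul] at ha
    funext i
    have h1 := ((hF a (left_ne_zero_of_mul ha)).2 i).1
    rw [(hG a (right_ne_zero_of_mul ha)).2 i] at h1
    exact_mod_cast h1
  refine ⟨⟨r, ⟨F, hF0, fun a ha => ⟨?_, fun i => ((hF a ha).2 i).1⟩⟩, huniq⟩, ?_⟩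
  · rw [← tailSpan_zero]
    exact (hF a ha).1
  intro t ht
  obtain rfl := huniq t ht
  have hsum : I ≤ idealOfVars (Fin n) K → ∀ a, eval a F ≠ 0 →
      (I.spanFinrank : ℕ∞) + ∑ i : Fin n, idealLength K (I ⊔ tailSpan a (i + 1))
        ((idealOfVars (Fin n) K * I ⊔ tailSpan a (i + 1)).colon {linForm a i}) =
      ((∑ i, t i : ℕ) : ℕ∞) := by
    intro hIm a ha
    rw [spanFinrank_add_sum_idealLength hI hIm (hF a ha).1, Nat.cast_sum]
    exact Finset.sum_congr rfl fun i _ => ((hF a ha).2 i).2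
  obtain ⟨a₀, ha₀⟩ := exists_eval_ne_zero hF0
  refine ⟨?_, fun hne => ?_⟩
  · rw [isCompletelyMFull_iff]
    constructor
    · intro h
      -- One point `b` suffices, because the sum of the `t i` is the same at all points of the open
      -- set. The bottom of the recursion supplies `I ⊆ 𝔪`.
      obtain ⟨b, hb, -, hIb, hcol⟩ := exists_colonCondition_of_sectionMFull (I := I) (F := F)
        le_rfl a₀ ha₀ (by rwa [tailSpan_card, sup_bot_eq])
      rw [(hF b hb).1] at hIb
      have h1 := hsum hIb b hb
      rw [Finset.sum_eq_zero fun i _ => colonCondition_iff.mp (hcol i i.2), add_zero] at h1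
      exact_mod_cast h1
    · intro h
      -- For `I = R` all `t i` vanish, whereas the unit ideal needs a generator.
      have hne : I ≠ ⊤ := by
        rintro rfl
        have h0 : ∀ i, t i = 0 := fun i => by
          have h1 := ((hF a₀ ha₀).2 i).2
          rw [idealLength_eq_zero_iff.mpr (by rw [top_sup_eq]; exact le_top)] at h1
          exact_mod_cast h1.symm
        rw [Finset.sum_eq_zero fun i _ => h0 i] at h
        rw [Submodule.spanFinrank_eq_zero_iff_eq_bot (IsNoetherian.noetherian _)] at h
        exact top_ne_bot h
      have hIm := le_idealOfVars_of_ne_top hI hne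
      have h1 := sectionMFull_of_forall_colonCondition (I := I) (F := F) (fun a ha =>
        ⟨by rwa [(hF a ha).1], fun i => ?_⟩) le_rfl a₀ ha₀
      · rwa [tailSpan_card, sup_bot_eq] at h1
      · have h2 := hsum hIm a ha
        rw [← h] at h2
        -- `μ(I)` is finite and may be cancelled, so the defects add up to zero and each of them
        -- vanishes, at every point of the open set.
        have h3 := ENat.add_right_injective_of_ne_top (ENat.natCast_ne_top _)
            (h2.trans (add_zero _).symm)
        exact colonCondition_iff.mpr (Finset.sum_eq_zero_iff.mp h3 i (Finset.mem_univ i))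
  · have h1 := hsum (le_idealOfVars_of_ne_top hI hne) a₀ ha₀
    have h2 : (I.spanFinrank : ℕ∞) ≤ ((∑ i, t i : ℕ) : ℕ∞) := h1 ▸ le_self_add
    exact_mod_cast h2
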